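/- Let $(\mathcal S,\mathcal A,\mathbb P,R,\gamma)$ be a Markov decision process: $\mathcal S,\mathcal A$ are measurable spaces, $\nu$ is a $\sigma$-finite reference measure on $\mathcal A$ (for instance counting measure on a finite set or Lebesgue measure on a compact region), $\mathbb P(\cdot\mid s,a)$ is a Markov kernel from $\mathcal S\times\mathcal A$ to $\mathcal S$, $R:\mathcal S\times\mathcal A\to\mathbb R$ is measurable and $\gamma\in(0,1)$. Let $\pi_\theta(a\mid s)>0$, $\theta\in\mathbb R^d$, be a family of policies, given by probability densities with respect to $\nu$ that are measurable in $(s,a)$. Fix $s_0\in\mathcal S$ and put $J(\theta)=\mathbb E\big[\sum_{t\ge0}\gamma^tR(s_t,a_t)\big]$, where the trajectory starts at $s_0$ and $a_t\sim\pi_\theta(\cdot\mid s_t)$, $s_{t+1}\sim\mathbb P(\cdot\mid s_t,a_t)$. Assume that (i) $|R|\le U_R$ for some constant $U_R$; (ii) $\theta\mapsto\pi_\theta(a\mid s)$ is differentiable for all $(s,a)$, and there are constants $L_\Theta,B_\Theta$ such that for all $(s,a)$ and all $\theta,\theta^1,\theta^2\in\mathbb R^d$, $\|\nabla\log\pi_{\theta^1}(a\mid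 s)-\nabla\log\pi_{\theta^2}(a\mid s)\|\le L_\Theta\|\theta^1-\theta^2\|$ and $\|\nabla\log\pi_\theta(a\mid s)\|\le B_\Theta$ (all gradients are with respect to $\theta$); (iii) the stepsizes satisfy $\alpha_k\ge0$, $\sum_k\alpha_k=\infty$ and $\sum_k\alpha_k^2<\infty$. Let $(\theta_k)_{k\ge0}$ be the iterates of the random-horizon policy gradient algorithm (RPG) started at $\theta_0\in\mathbb R^d$. In iteration $k$, given the past, the algorithm draws a horizon $T$ with $P(T=t)=(1-\gamma)\gamma^t$ and, independently of it, simulates a trajectory under $\pi_{\theta_k}$ from $s_0$ up to the pair $(s_T,a_T)$. It then draws an independent horizon $T'$ with $P(T'=t)=(1-\gamma^{1/2})\gamma^{t/2}$ and simulates a new trajectory $(s'_t,a'_t)_{0\le t\le T'}$ under $\pi_{\theta_k}$ from $(s'_0,a'_0)=(s_T,a_T)$, and it sets $$\hat Q=\sum_{t=0}^{T'}\gamma^{t/2}R(s'_t,a'_t),\qquad \theta_{k+1}=\theta_k+\frac{\alpha_k}{1-\gamma}\,\hat Q\,\nabla\log\pi_{\theta_k}(a_T\mid s_T).$$ Then $J$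 is differentiable on $\mathbb R^d$ and, almost surely, $\lim_{k\to\infty}\|\nabla J(\theta_k)\|=0$. In particular, almost surely every limit point of $(\theta_k)$, and so its limit whenever it converges, belongs to the set $\Theta^*=\{\theta:\nabla J(\theta)=0\}$ of stationary points of $J$. -/

import Mathlib

open MeasureTheory ProbabilityTheory Filter Topology

noncomputable section

namespace RPG

/-- The parameter space `ℝ^d` with the Euclidean norm. -/
abbrev Param (d : ℕ) : Type := EuclideanSpace ℝ (Fin d)

/-- A discounted Markov decision process with state space `S` and action space `A`: a Markov
transition kernel, a (deterministic, measurable) reward function and a discount factor. -/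
structure MDP (S A : Type*) [MeasurableSpace S] [MeasurableSpace A] where
  /-- the law of the next state, given the current state and action -/
  trans : Kernel (S × A) S
  markov : IsMarkovKernel trans
  reward : S × A → ℝ
  measurable_reward : Measurable reward
  discount : ℝ
  discount_pos : 0 < discount
  discount_lt_one : discount < 1

/-- A family of stochastic policies indexed by `θ ∈ ℝ^d`, given by densities `π_θ(a | s)` with
respect to a reference measure `ν` on actions (the counting measure when `A` is finite, Lebesgue
measure when `A` is a compact region). The densities are positive, so that `log π_θ(a | s)` is
meaningful. -/
structure PolicyFamily (d : ℕ) (S : Type*) {A : Type*} [MeasurableSpace S] [MeasurableSpace A]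
    (ν : Measure A) where
  density : Param d → S → A → ℝ
  measurable_density : ∀ θ, Measurable (fun x : S × A => density θ x.1 x.2)
  density_pos : ∀ θ s a, 0 < density θ s a
  lintegral_density : ∀ θ s, ∫⁻ a, ENNReal.ofReal (density θ s a) ∂ν = 1

variable {d : ℕ} {S A : Type*} [MeasurableSpace S] [MeasurableSpace A]
  {ν : Measure A} [SigmaFinite ν]

instance (M : MDP S A) : IsMarkovKernel M.trans := M.markov

namespace PolicyFamily

/-- The policy `π_θ : S → 𝒫(A)` as a Markov kernel. -/
def kernel (π : PolicyFamily d S ν) (θ : Param d) : Kernel S A :=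
  (Kernel.const S ν).withDensity (fun s a => ENNReal.ofReal (π.density θ s a))

instance (π : PolicyFamily d S ν) (θ : Param d) : IsMarkovKernel (π.kernel θ) := by
  refine ⟨fun s => ⟨?_⟩⟩
  have h : Measurable (Function.uncurry
      (fun s a => ENNReal.ofReal (π.density θ s a))) :=
    (π.measurable_density θ).ennreal_ofReal
  rw [kernel, Kernel.withDensity_apply _ h, withDensity_apply _ MeasurableSet.univ,
    Measure.restrict_univ, Kernel.const_apply]
  exact π.lintegral_density θ s

/-- The score function `∇_θ log π_θ(a | s)`, at the state-action pair `x = (s, a)`. -/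
def score (π : PolicyFamily d S ν) (θ : Param d) (x : S × A) : Param d :=
  gradient (fun η => Real.log (π.density η x.1 x.2)) θ

end PolicyFamily

namespace MDP

variable (M : MDP S A) (π : PolicyFamily d S ν)

/-- One transition of the state-action chain: `s' ∼ ℙ(· | s, a)`, then `a' ∼ π_θ(· | s')`. -/
def step (θ : Param d) : Kernel (S × A) (S × A) :=
  M.trans ⊗ₖ (π.kernel θ).prodMkLeft (S × A)

instance (θ : Param d) : IsMarkovKernel (M.step π θ) := by
  unfold step; infer_instance

/-- The law of the state-action trajectory `(s_t, a_t)_{t ≥ 0}` under `π_θ`, as a function of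
the initial pair `(s_0, a_0)`. -/
def trajKernel (θ : Param d) : Kernel (S × A) (ℕ → S × A) :=
  (Kernel.traj (X := fun _ => S × A)
    (fun n => (M.step π θ).comap (fun h => h ⟨n, Finset.mem_Iic.2 le_rfl⟩)
      (measurable_pi_apply _)) 0).comap
    (fun x _ => x) (measurable_pi_lambda _ fun _ => measurable_id)

instance (θ : Param d) : IsMarkovKernel (M.trajKernel π θ) := by
  unfold trajKernel; infer_instance

/-- The law of the state-action trajectory under `π_θ` with initial state `s` and initial action
`a_0 ∼ π_θ(· | s)`. -/
def trajFrom (θ : Param d) (s : S) : Measure (ℕ → S × A) :=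
  ((M.trajKernel π θ) ∘ₖ (Kernel.id ×ₖ π.kernel θ)) s

instance (θ : Param d) (s : S) : IsProbabilityMeasure (M.trajFrom π θ s) := by
  unfold trajFrom; infer_instance

/-- The value function `V_{π_θ}(s)`: expected infinite-horizon discounted reward. -/
def value (θ : Param d) (s : S) : ℝ :=
  ∫ τ, ∑' t : ℕ, M.discount ^ t * M.reward (τ t) ∂(M.trajFrom π θ s)

/-- The objective `J(θ) = V_{π_θ}(s₀)`. -/
def objective (s₀ : S) (θ : Param d) : ℝ := M.value π θ s₀

/-- The set `Θ*` of stationary points of `J`. -/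
def stationaryPoints (s₀ : S) : Set (Param d) :=
  {θ | HasGradientAt (M.objective π s₀) 0 θ}

/-- The law of a horizon with `P(T = t) = (1 - γ) γ^t`. -/
def outerHorizon : Measure ℕ :=
  geometricMeasure ⟨1 - M.discount, by linarith [M.discount_lt_one], by linarith [M.discount_pos]⟩

instance : IsProbabilityMeasure M.outerHorizon := by
  unfold outerHorizon; infer_instance

/-- The law of a horizon with `P(T' = t) = (1 - γ^{1/2}) γ^{t/2}`. -/
def innerHorizon : Measure ℕ :=
  geometricMeasure ⟨1 - √M.discount,
    sub_nonneg.2 (Real.sqrt_le_one.2 M.discount_lt_one.le),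
    sub_le_self _ (Real.sqrt_nonneg _)⟩

instance : IsProbabilityMeasure M.innerHorizon := by
  unfold innerHorizon; infer_instance

end MDP

/-- A horizon together with a state-action trajectory, of which only the pairs at times
`0, …, horizon` are ever read. -/
abbrev Rollout (S A : Type*) : Type _ := ℕ × (ℕ → S × A)

/-- The last pair `(s_T, a_T)` of a rollout. -/
def Rollout.last (x : Rollout S A) : S × A := x.2 x.1

lemma Rollout.measurable_last : Measurable (Rollout.last : Rollout S A → S × A) :=
  measurable_from_prod_countable_right fun n => measurable_pi_apply n

namespace MDP

variable (M : MDP S A) (π : PolicyFamily d S ν)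

/-- The joint law, at parameter `θ`, of everything sampled in one iteration: a rollout from `s₀`
with horizon `T ∼ Geom(1 - γ)`, followed by a rollout from its last pair `(s_T, a_T)` with horizon
`T' ∼ Geom(1 - γ^{1/2})`. The horizons are independent of the simulated dynamics. -/
def iterationLaw (s₀ : S) (θ : Param d) : Measure (Rollout S A × Rollout S A) :=
  (M.outerHorizon.prod (M.trajFrom π θ s₀)) ⊗ₘ
    (Kernel.const (Rollout S A) M.innerHorizon ×ₖ
      (M.trajKernel π θ).comap Rollout.last Rollout.measurable_last)

/-- The estimate `Q̂ = ∑_{t=0}^{T'} γ^{t/2} R(s_t, a_t)` computed from a rollout. -/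
def estQ (x : Rollout S A) : ℝ :=
  ∑ t ∈ Finset.range (x.1 + 1), √M.discount ^ t * M.reward (x.2 t)

/-- The stochastic policy gradient `(1 - γ)⁻¹ Q̂(s_T, a_T) ∇ log π_θ(a_T | s_T)`. -/
def gradEst (θ : Param d) (x : Rollout S A × Rollout S A) : Param d :=
  ((1 - M.discount)⁻¹ * M.estQ x.2) • π.score θ x.1.last

/-- Bounded rewards; policy differentiable in `θ`; score function Lipschitz in `θ`
and bounded, uniformly over state-action pairs. -/
structure Regular : Prop where
  bounded_reward : ∃ U : ℝ, ∀ x, |M.reward x| ≤ U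
  differentiable_density : ∀ s a, Differentiable ℝ (fun θ => π.density θ s a)
  lipschitz_score : ∃ L : ℝ, ∀ x θ₁ θ₂, ‖π.score θ₁ x - π.score θ₂ x‖ ≤ L * ‖θ₁ - θ₂‖
  bounded_score : ∃ B : ℝ, ∀ x θ, ‖π.score θ x‖ ≤ B

/-- `θ` is the sequence of iterates of the random-horizon policy gradient algorithm started at
`θ₀`, with stepsizes `α`, on a probability space `(Ω, μ)` with filtration `ℱ`; `X k` collects the
samples drawn in iteration `k`. Given the past `ℱ k`, these are drawn from the
iteration law at the current parameter `θ k`. -/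
structure IsRPG {Ω : Type*} {mΩ : MeasurableSpace Ω} (μ : Measure Ω) (ℱ : Filtration ℕ mΩ)
    (s₀ : S) (θ₀ : Param d) (α : ℕ → ℝ)
    (X : ℕ → Ω → Rollout S A × Rollout S A) (θ : ℕ → Ω → Param d) : Prop where
  measurable_param : ∀ k, Measurable[ℱ k] (θ k)
  measurable_sample : ∀ k, Measurable[ℱ (k + 1)] (X k)
  condLaw_sample : ∀ k (B : Set (Rollout S A × Rollout S A)), MeasurableSet B →
    μ⟦X k ⁻¹' B | ℱ k⟧ =ᵐ[μ] fun ω => (M.iterationLaw π s₀ (θ k ω)).real B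
  param_zero : ∀ ω, θ 0 ω = θ₀
  param_succ : ∀ k ω, θ (k + 1) ω = θ k ω + α k • M.gradEst π (θ k ω) (X k ω)

end MDP

/-- Robbins–Monro stepsizes: nonnegative, `∑ α_k = ∞` and `∑ α_k² < ∞`. -/
structure RobbinsMonro (α : ℕ → ℝ) : Prop where
  nonneg : ∀ k, 0 ≤ α k
  sum_eq_top : Tendsto (fun n => ∑ k ∈ Finset.range n, α k) atTop atTop
  summable_sq : Summable (fun k => α k ^ 2)

end RPG

end

/-! Let G(θ) be the mean of one stochastic gradient at θ. Everything rests on one inequality,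
uniform in θ and θ': |J(θ') - J(θ) - ⟨G(θ), θ' - θ⟩| ≤ C‖θ' - θ‖². It shows that ∇J = G, that G is
Lipschitz (`norm_sub_le_of_quadratic_expansion`), and that J satisfies an ascent inequality along
the iterates.

The expansion is `abs_vValue_sub_sub_le`. A change of policy is an importance weight exp(log π_θ' -
log π_θ), controlled to second order by the bounds on the score. Subtracting Bellman equations, the
remainder D of the value function obeys |D| ≤ c‖θ' - θ‖² + γ sup|D|, so it is quadratically small.
The linear coefficient is the value of the reward Q_θ · ⟨score, θ' - θ⟩. It equals ⟨G(θ), θ' - θ⟩ by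
`inner_integral_gradEst`: the horizon T samples the discounted occupation measure, and the inner
rollout estimates Q_θ without bias (`integral_estQ`).

Stochastic gradients are bounded, so expectations in the ascent inequality telescope to ∑ α_k
E‖G(θ_k)‖² < ∞, and the noise is a martingale bounded in L², hence almost surely convergent. These
two facts and ∑ α_k = ∞ force G(θ_k) → 0 path by path (`tendsto_norm_zero_of_perturbed_recursion`):
an excursion of ‖G‖ from 2ε down to ε would need more displacement than the tails allow. Continuity
of G then handles limit points. -/

noncomputable section

namespace RPG

/-! ### Measurable dependence of trajectory laws on a parameter. -/

section ParametrizedKernels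

variable {T α β : Type*} [MeasurableSpace T] [MeasurableSpace α] [MeasurableSpace β]

/-- The composition-product of measurably parametrized measures and kernels is measurable in the
parameter. -/
lemma measurable_compProd_param {μ : T → Measure α} (hμ : Measurable μ)
    [hμ' : ∀ t, IsProbabilityMeasure (μ t)] {κ : T → Kernel α β} [hκ' : ∀ t, IsMarkovKernel (κ t)]
    (hκ : Measurable fun p : T × α => κ p.1 p.2) :
    Measurable fun t => μ t ⊗ₘ κ t := by
  -- With both families bundled as kernels, measurability in the parameter is part of the
  -- composition-product being a kernel.
  let K : Kernel T α := ⟨μ, hμ⟩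
  let H : Kernel (T × α) β := ⟨fun p => κ p.1 p.2, hκ⟩
  have : IsMarkovKernel K := ⟨hμ'⟩
  have : IsMarkovKernel H := ⟨fun p => (hκ' p.1).isProbabilityMeasure p.2⟩
  have h : (fun t => μ t ⊗ₘ κ t) = fun t => (K ⊗ₖ H) t := by
    funext t
    rw [Kernel.compProd_apply_eq_compProd_sectR]
    congr 1
  rw [h]
  exact (K ⊗ₖ H).measurable

lemma measurable_comp_param {μ : T → Measure α} (hμ : Measurable μ)
    [∀ t, IsProbabilityMeasure (μ t)] {κ : T → Kernel α β} [∀ t, IsMarkovKernel (κ t)]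
    (hκ : Measurable fun p : T × α => κ p.1 p.2) :
    Measurable fun t => κ t ∘ₘ μ t := by
  have h : (fun t => κ t ∘ₘ μ t) = fun t => (μ t ⊗ₘ κ t).map Prod.snd := by
    funext t
    rw [← Measure.snd_compProd, Measure.snd]
  rw [h]
  exact (Measure.measurable_map _ measurable_snd).comp (measurable_compProd_param hμ hκ)

variable {Y : Type*} [MeasurableSpace Y]

/-- Extend a path up to time `n` by one more point. -/
def appendPoint (n : ℕ) (p : (Finset.Iic n → Y) × Y) : Finset.Iic (n + 1) → Y :=
  fun i => if h : i.1 ≤ n then p.1 ⟨i.1, Finset.mem_Iic.2 h⟩ else p.2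

lemma measurable_appendPoint (n : ℕ) : Measurable (appendPoint (Y := Y) n) := by
  refine measurable_pi_iff.2 fun i => ?_
  unfold appendPoint
  split_ifs <;> fun_prop

/-- The Ionescu-Tulcea measure depends measurably on a parameter of the transition kernels. -/
lemma measurable_traj_param
    {κ : T → (n : ℕ) → Kernel ((i : Finset.Iic n) → (fun _ => Y) i.1) Y}
    [∀ t n, IsMarkovKernel (κ t n)]
    (hκ : ∀ n, Measurable fun p : T × ((i : Finset.Iic n) → (fun _ => Y) i.1) => κ p.1 n p.2) :
    Measurable fun p : T × (Finset.Iic 0 → Y) =>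
      (Kernel.traj (X := fun _ => Y) (κ p.1) 0 p.2 : Measure (ℕ → Y)) := by
  have i₁ (n : ℕ) (p : T × (Finset.Iic 0 → Y)) : IsProbabilityMeasure
      (Kernel.partialTraj (X := fun _ => Y) (κ p.1) 0 n p.2) :=
    IsMarkovKernel.isProbabilityMeasure _
  have i₂ (p : T × (Finset.Iic 0 → Y)) : IsProbabilityMeasure
      (Kernel.traj (X := fun _ => Y) (κ p.1) 0 p.2) :=
    IsMarkovKernel.isProbabilityMeasure _
  have key : ∀ n, Measurable fun p : T × (Finset.Iic 0 → Y) =>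
      (Kernel.partialTraj (X := fun _ => Y) (κ p.1) 0 n p.2) := by
    intro n
    induction n with
    | zero =>
      simp only [Kernel.partialTraj_self, Kernel.id_apply]
      exact Measure.measurable_dirac.comp measurable_snd
    | succ n ih =>
      -- The path law up to time n + 1 is the law up to time n followed by one transition, so
      -- measurability propagates by induction.
      have h : (fun p : T × (Finset.Iic 0 → Y) =>
          (Kernel.partialTraj (X := fun _ => Y) (κ p.1) 0 (n + 1) p.2)) =
          fun p => ((Kernel.partialTraj (X := fun _ => Y) (κ p.1) 0 n p.2) ⊗ₘ κ p.1 n).map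
            (appendPoint n) := by
        funext p
        rw [Kernel.partialTraj_compProd_eq_map_traj (Nat.zero_le n),
          ← Kernel.traj_map_frestrictLe_apply,
          Measure.map_map (measurable_appendPoint n) (by fun_prop)]
        congr 1
        funext τ i
        simp only [Function.comp, appendPoint, Preorder.frestrictLe_apply]
        split_ifs with hi
        · rfl
        · have : i.1 = n + 1 := by have := Finset.mem_Iic.1 i.2; omega
          rw [this]
      rw [h]
      refine (Measure.measurable_map _ (measurable_appendPoint n)).comp ?_
      refine measurable_compProd_param ih (κ := fun p => κ p.1 n) ?_
      exact (hκ n).comp ((measurable_fst.comp measurable_fst).prodMk measurable_snd)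
  refine Measurable.measure_of_isPiSystem_of_isProbabilityMeasure
    generateFrom_measurableCylinders.symm isPiSystem_measurableCylinders ?_
  intro s hs
  -- A cylinder over a finite set of times is also one over an initial window, where only a
  -- finite-horizon law is involved.
  obtain ⟨N, A, mA, rfl⟩ : ∃ N, ∃ A : Set ((i : Finset.Iic N) → (fun _ => Y) i.1),
      MeasurableSet A ∧ s = Preorder.frestrictLe N ⁻¹' A := by
    obtain ⟨I, A, mA, rfl⟩ := (mem_measurableCylinders s).1 hs
    exact ⟨I.sup id, Finset.restrict₂ (π := fun _ => Y) (Finset.subset_Iic_sup_id I) ⁻¹' A,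
      Finset.measurable_restrict₂ _ mA, rfl⟩
  have h : ∀ p : T × (Finset.Iic 0 → Y),
      (Kernel.traj (X := fun _ => Y) (κ p.1) 0 p.2 : Measure (ℕ → Y))
        (Preorder.frestrictLe N ⁻¹' A) =
      Kernel.partialTraj (X := fun _ => Y) (κ p.1) 0 N p.2 A := by
    intro p
    rw [← Kernel.traj_map_frestrictLe_apply,
      Measure.map_apply (Preorder.measurable_frestrictLe N) mA]
  simp only [h]
  exact (Measure.measurable_coe mA).comp (key N)

end ParametrizedKernels

end RPG

/-! ### Joint measurability of the policy, the dynamics and the iteration law. -/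

namespace RPG

variable {d : ℕ} {S A : Type*} [MeasurableSpace S] [MeasurableSpace A]
  {ν : Measure A} [SigmaFinite ν]

namespace PolicyFamily

variable (π : PolicyFamily d S ν)

lemma kernel_apply (θ : Param d) (s : S) :
    π.kernel θ s = ν.withDensity fun a => ENNReal.ofReal (π.density θ s a) := by
  have h : Measurable (Function.uncurry fun s a => ENNReal.ofReal (π.density θ s a)) :=
    (π.measurable_density θ).ennreal_ofReal
  rw [kernel, Kernel.withDensity_apply _ h, Kernel.const_apply]

variable {π}

-- Carathéodory's criterion: continuity in θ and measurability in (s, a) give joint measurability.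
omit [SigmaFinite ν] in
lemma measurable_density_param (hπ : ∀ s a, Continuous fun θ => π.density θ s a) :
    Measurable fun p : Param d × (S × A) => π.density p.1 p.2.1 p.2.2 :=
  measurable_uncurry_of_continuous_of_measurable (u := fun θ (x : S × A) => π.density θ x.1 x.2)
    (fun x => hπ x.1 x.2) π.measurable_density

lemma measurable_kernel_param (hπ : ∀ s a, Continuous fun θ => π.density θ s a) :
    Measurable fun p : Param d × S => π.kernel p.1 p.2 := by
  refine Measure.measurable_of_measurable_coe _ fun B hB => ?_
  simp only [kernel_apply, withDensity_apply _ hB]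
  refine Measurable.lintegral_prod_right' (ν := ν.restrict B)
    (f := fun q : (Param d × S) × A => ENNReal.ofReal (π.density q.1.1 q.1.2 q.2)) ?_
  exact ((measurable_density_param hπ).comp
    ((measurable_fst.comp measurable_fst).prodMk
      ((measurable_snd.comp measurable_fst).prodMk measurable_snd))).ennreal_ofReal

end PolicyFamily

namespace MDP

variable (M : MDP S A) (π : PolicyFamily d S ν)

lemma step_apply (θ : Param d) (x : S × A) : M.step π θ x = M.trans x ⊗ₘ π.kernel θ := by
  rw [step, Kernel.compProd_apply_eq_compProd_sectR]
  congr 1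

lemma trajFrom_eq (θ : Param d) (s : S) :
    M.trajFrom π θ s = M.trajKernel π θ ∘ₘ ((Measure.dirac s).prod (π.kernel θ s)) := by
  rw [trajFrom, Kernel.comp_apply, Kernel.prod_apply, Kernel.id_apply]

variable {π}

lemma measurable_step_param (hπ : ∀ s a, Continuous fun θ => π.density θ s a) :
    Measurable fun p : Param d × (S × A) => M.step π p.1 p.2 := by
  simp only [step_apply]
  refine measurable_compProd_param (μ := fun p : Param d × (S × A) => M.trans p.2)
    (κ := fun p => π.kernel p.1) (M.trans.measurable.comp measurable_snd) ?_
  exact Measurable.comp (g := fun p : Param d × S => π.kernel p.1 p.2)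
    (PolicyFamily.measurable_kernel_param hπ)
    (f := fun q : (Param d × (S × A)) × S => (q.1.1, q.2)) (by fun_prop)

lemma measurable_trajKernel_param (hπ : ∀ s a, Continuous fun θ => π.density θ s a) :
    Measurable fun p : Param d × (S × A) => M.trajKernel π p.1 p.2 := by
  have h := measurable_traj_param (Y := S × A)
    (κ := fun (θ : Param d) n => (M.step π θ).comap (fun h => h ⟨n, Finset.mem_Iic.2 le_rfl⟩)
      (measurable_pi_apply _)) fun n => by
        simp only [Kernel.comap_apply]
        exact Measurable.comp (g := fun p : Param d × (S × A) => M.step π p.1 p.2)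
          (f := fun q : Param d × (Finset.Iic n → S × A) =>
            (q.1, q.2 ⟨n, Finset.mem_Iic.2 le_rfl⟩))
          (M.measurable_step_param hπ) (by fun_prop)
  exact h.comp (f := fun p : Param d × (S × A) => (p.1, fun _ => p.2)) (by fun_prop)

lemma measurable_trajFrom_param (hπ : ∀ s a, Continuous fun θ => π.density θ s a) (s : S) :
    Measurable fun θ => M.trajFrom π θ s := by
  simp only [trajFrom_eq]
  refine measurable_comp_param (κ := fun θ => M.trajKernel π θ) ?_
    (M.measurable_trajKernel_param hπ)
  simp only [← Measure.compProd_const]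
  refine measurable_compProd_param (κ := fun θ => Kernel.const S (π.kernel θ s))
    measurable_const ?_
  simp only [Kernel.const_apply]
  exact (PolicyFamily.measurable_kernel_param hπ).comp (measurable_fst.prodMk measurable_const)

lemma measurable_iterationLaw (hπ : ∀ s a, Continuous fun θ => π.density θ s a) (s : S) :
    Measurable fun θ => M.iterationLaw π s θ := by
  unfold iterationLaw
  refine measurable_compProd_param (μ := fun θ => M.outerHorizon.prod (M.trajFrom π θ s))
    (κ := fun θ => Kernel.const (Rollout S A) M.innerHorizon ×ₖ
      (M.trajKernel π θ).comap Rollout.last Rollout.measurable_last) ?_ ?_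
  · simp only [← Measure.compProd_const]
    refine measurable_compProd_param (κ := fun θ => Kernel.const ℕ (M.trajFrom π θ s))
      measurable_const ?_
    simp only [Kernel.const_apply]
    exact (M.measurable_trajFrom_param hπ s).comp measurable_fst
  · simp only [Kernel.prod_apply, Kernel.const_apply, Kernel.comap_apply,
      ← Measure.compProd_const]
    refine measurable_compProd_param (T := Param d × Rollout S A)
      (κ := fun p => Kernel.const ℕ (M.trajKernel π p.1 p.2.last)) measurable_const ?_
    simp only [Kernel.const_apply]
    exact Measurable.comp (g := fun p : Param d × (S × A) => M.trajKernel π p.1 p.2)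
      (f := fun q : (Param d × Rollout S A) × ℕ => (q.1.1, q.1.2.last))
      (M.measurable_trajKernel_param hπ) ((measurable_fst.comp measurable_fst).prodMk
        (Rollout.measurable_last.comp (measurable_snd.comp measurable_fst)))

instance (s : S) (θ : Param d) : IsProbabilityMeasure (M.iterationLaw π s θ) := by
  unfold iterationLaw; infer_instance

end MDP

end RPG

/-! ### Integrals of bounded functions under probability measures. -/

section BoundedIntegrals

variable {α : Type*} [MeasurableSpace α] {μ : Measure α} [IsProbabilityMeasure μ]

lemma abs_integral_le_of_abs_le {f : α → ℝ} {K : ℝ} (hf : ∀ x, |f x| ≤ K) :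
    |∫ x, f x ∂μ| ≤ K := by
  have h := norm_integral_le_of_norm_le_const (μ := μ) (f := f) (ae_of_all _ hf)
  simpa using h

lemma integrable_of_abs_le {f : α → ℝ} (hm : Measurable f) {K : ℝ} (hf : ∀ x, |f x| ≤ K) :
    Integrable f μ :=
  Integrable.of_bound hm.aestronglyMeasurable K (ae_of_all _ hf)

end BoundedIntegrals

/-! ### Marginals of the state-action chain, discounted values and the Bellman equation. -/

namespace RPG

variable {d : ℕ} {S A : Type*} [MeasurableSpace S] [MeasurableSpace A]
  {ν : Measure A} [SigmaFinite ν]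

namespace MDP

variable (M : MDP S A) (π : PolicyFamily d S ν)

/-- The law of the state-action pair at time `t` as a function of the initial pair. -/
def marginal (θ : Param d) (t : ℕ) : Kernel (S × A) (S × A) :=
  (M.trajKernel π θ).map fun τ => τ t

instance (θ : Param d) (t : ℕ) : IsMarkovKernel (M.marginal π θ t) :=
  Kernel.IsMarkovKernel.map _ (measurable_pi_apply t)

lemma integral_marginal (θ : Param d) (t : ℕ) (x : S × A) {f : S × A → ℝ} (hf : Measurable f) :
    ∫ y, f y ∂M.marginal π θ t x = ∫ τ, f (τ t) ∂M.trajKernel π θ x := by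
  rw [marginal, Kernel.map_apply _ (measurable_pi_apply t),
    integral_map (measurable_pi_apply t).aemeasurable hf.aestronglyMeasurable]

lemma marginal_zero (θ : Param d) : M.marginal π θ 0 = Kernel.id := by
  ext1 x
  rw [marginal, Kernel.map_apply _ (measurable_pi_apply 0), trajKernel, Kernel.comap_apply,
    Kernel.id_apply]
  have h : (fun τ : ℕ → S × A => τ 0) =
      (fun h : (i : Finset.Iic 0) → (fun _ => S × A) i.1 => h ⟨0, Finset.mem_Iic.2 le_rfl⟩) ∘
        Preorder.frestrictLe 0 := rfl
  rw [h, ← Measure.map_map (measurable_pi_apply _) (by fun_prop),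
    Kernel.traj_map_frestrictLe_apply, Kernel.partialTraj_self, Kernel.id_apply,
    Measure.map_dirac' (measurable_pi_apply _)]

/-- Markov property: the transition kernels of the trajectory are given the whole history but read
only its last pair. -/
lemma marginal_succ (θ : Param d) (t : ℕ) :
    M.marginal π θ (t + 1) = M.step π θ ∘ₖ M.marginal π θ t := by
  ext1 x
  rw [Kernel.comp_apply, marginal, marginal, Kernel.map_apply _ (measurable_pi_apply _),
    Kernel.map_apply _ (measurable_pi_apply _), trajKernel, Kernel.comap_apply]
  set κ : (n : ℕ) → Kernel ((i : Finset.Iic n) → (fun _ => S × A) i.1) (S × A) := fun n =>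
    (M.step π θ).comap (fun h => h ⟨n, Finset.mem_Iic.2 le_rfl⟩) (measurable_pi_apply _) with hκ
  set x₀ : (i : Finset.Iic 0) → (fun _ => S × A) i.1 := fun _ => x
  have h₁ : (Kernel.traj (X := fun _ => S × A) κ 0 x₀).map (fun τ : ℕ → S × A => τ (t + 1)) =
      κ t ∘ₘ Kernel.partialTraj (X := fun _ => S × A) κ 0 t x₀ := by
    rw [← Measure.snd_compProd, Kernel.partialTraj_compProd_eq_map_traj (Nat.zero_le t),
      Measure.snd, Measure.map_map measurable_snd (by fun_prop)]
    rfl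
  have h₂ : (fun τ : ℕ → S × A => τ t) =
      (fun h : (i : Finset.Iic t) → (fun _ => S × A) i.1 => h ⟨t, Finset.mem_Iic.2 le_rfl⟩) ∘
        Preorder.frestrictLe t := rfl
  rw [h₁, h₂, ← Measure.map_map (measurable_pi_apply _) (by fun_prop),
    Kernel.traj_map_frestrictLe_apply]
  ext B hB
  rw [Measure.bind_apply hB (Kernel.aemeasurable _), Measure.bind_apply hB (Kernel.aemeasurable _),
    lintegral_map (Kernel.measurable_coe _ hB) (measurable_pi_apply _)]
  rfl

/-- All marginals are powers of the same kernel, so the first transition can be split off instead of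
the last. The Bellman equation needs this order. -/
lemma marginal_succ' (θ : Param d) (t : ℕ) :
    M.marginal π θ (t + 1) = M.marginal π θ t ∘ₖ M.step π θ := by
  induction t with
  | zero => rw [marginal_succ, marginal_zero, Kernel.comp_id, Kernel.id_comp]
  | succ t ih =>
    rw [marginal_succ, ih, ← Kernel.comp_assoc, ← marginal_succ, ih]

lemma integral_step (θ : Param d) (x : S × A) {f : S × A → ℝ} (hf : Measurable f) {K : ℝ}
    (hK : ∀ x, |f x| ≤ K) :
    ∫ y, f y ∂M.step π θ x = ∫ s, ∫ a, f (s, a) ∂π.kernel θ s ∂M.trans x := by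
  rw [step_apply, Measure.integral_compProd (integrable_of_abs_le hf hK)]

/-- The action-value function of the policy `π_θ` for the reward function `f`. -/
def qValue (θ : Param d) (f : S × A → ℝ) (x : S × A) : ℝ :=
  ∑' t : ℕ, M.discount ^ t * ∫ y, f y ∂M.marginal π θ t x

/-- The state-value function of the policy `π_θ` for the reward function `f`. -/
def vValue (θ : Param d) (f : S × A → ℝ) (s : S) : ℝ :=
  ∫ a, M.qValue π θ f (s, a) ∂π.kernel θ s

variable {f : S × A → ℝ} {K : ℝ}

lemma hasSum_discount_mul_const (K : ℝ) :
    HasSum (fun t : ℕ => M.discount ^ t * K) (K / (1 - M.discount)) := by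
  rw [div_eq_inv_mul]
  exact (hasSum_geometric_of_lt_one M.discount_pos.le M.discount_lt_one).mul_right K

lemma abs_discount_mul_le (t : ℕ) {c : ℝ} (hc : |c| ≤ K) :
    ‖M.discount ^ t * c‖ ≤ M.discount ^ t * K := by
  rw [Real.norm_eq_abs, abs_mul, abs_of_nonneg (pow_nonneg M.discount_pos.le t)]
  exact mul_le_mul_of_nonneg_left hc (pow_nonneg M.discount_pos.le t)

lemma hasSum_qValue (θ : Param d) (hK : ∀ x, |f x| ≤ K) (x : S × A) :
    HasSum (fun t : ℕ => M.discount ^ t * ∫ y, f y ∂M.marginal π θ t x) (M.qValue π θ f x) :=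
  (Summable.of_norm_bounded (M.hasSum_discount_mul_const K).summable
    fun t => M.abs_discount_mul_le t (abs_integral_le_of_abs_le hK)).hasSum

lemma abs_qValue_le (θ : Param d) (hK : ∀ x, |f x| ≤ K) (x : S × A) :
    |M.qValue π θ f x| ≤ K / (1 - M.discount) :=
  tsum_of_norm_bounded (M.hasSum_discount_mul_const K)
    fun t => M.abs_discount_mul_le t (abs_integral_le_of_abs_le hK)

lemma abs_vValue_le (θ : Param d) (hK : ∀ x, |f x| ≤ K) (s : S) :
    |M.vValue π θ f s| ≤ K / (1 - M.discount) :=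
  abs_integral_le_of_abs_le fun _ => M.abs_qValue_le π θ hK _

lemma measurable_qValue (θ : Param d) (hf : Measurable f) (hK : ∀ x, |f x| ≤ K) :
    Measurable (M.qValue π θ f) := by
  refine measurable_of_tendsto_metrizable
    (f := fun n x => ∑ t ∈ Finset.range n, M.discount ^ t * ∫ y, f y ∂M.marginal π θ t x)
    (fun n => ?_) (tendsto_pi_nhds.2 fun x => (M.hasSum_qValue π θ hK x).tendsto_sum_nat)
  refine Finset.measurable_fun_sum _ fun t _ => Measurable.const_mul ?_ _
  exact (hf.stronglyMeasurable.integral_kernel (κ := M.marginal π θ t)).measurable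

lemma measurable_vValue (θ : Param d) (hf : Measurable f) (hK : ∀ x, |f x| ≤ K) :
    Measurable (M.vValue π θ f) :=
  ((M.measurable_qValue π θ hf hK).stronglyMeasurable.integral_kernel_prod_right'
    (κ := π.kernel θ)).measurable

/-- Interchange of the discounted sum with the integral over the initial pair. -/
lemma hasSum_integral_qValue (θ : Param d) (hf : Measurable f) (hK : ∀ x, |f x| ≤ K)
    (ρ : Measure (S × A)) [IsProbabilityMeasure ρ] :
    HasSum (fun t : ℕ => M.discount ^ t * ∫ x, ∫ y, f y ∂M.marginal π θ t x ∂ρ)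
      (∫ x, M.qValue π θ f x ∂ρ) := by
  have hm : ∀ t, Measurable fun x => ∫ y, f y ∂M.marginal π θ t x := fun t =>
    (hf.stronglyMeasurable.integral_kernel (κ := M.marginal π θ t)).measurable
  have h := hasSum_integral_of_summable_integral_norm (μ := ρ)
    (F := fun (t : ℕ) x => M.discount ^ t * ∫ y, f y ∂M.marginal π θ t x)
    (fun t => (integrable_of_abs_le (hm t)
      fun x => abs_integral_le_of_abs_le hK).const_mul _) ?_
  · simpa only [integral_const_mul, qValue] using h
  · refine Summable.of_norm_bounded (M.hasSum_discount_mul_const K).summable fun t => ?_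
    exact abs_integral_le_of_abs_le fun x => by
      rw [abs_norm]
      exact M.abs_discount_mul_le t (abs_integral_le_of_abs_le hK)

/-- The Bellman equation. -/
lemma qValue_eq (θ : Param d) (hf : Measurable f) (hK : ∀ x, |f x| ≤ K) (x : S × A) :
    M.qValue π θ f x = f x + M.discount * ∫ s, M.vValue π θ f s ∂M.trans x := by
  have h₁ := (M.hasSum_qValue π θ hK x).tsum_eq
  rw [(M.hasSum_qValue π θ hK x).summable.tsum_eq_zero_add] at h₁
  have h₂ := (M.hasSum_integral_qValue π θ hf hK (M.step π θ x)).mul_left M.discount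
  have h₃ : ∀ t : ℕ, M.discount ^ (t + 1) * ∫ y, f y ∂M.marginal π θ (t + 1) x =
      M.discount * (M.discount ^ t *
        ∫ z, ∫ y, f y ∂M.marginal π θ t z ∂M.step π θ x) := fun t => by
    rw [marginal_succ', Kernel.integral_comp, pow_succ']
    · ring
    · exact integrable_of_abs_le hf hK
  simp only [h₃, h₂.tsum_eq] at h₁
  rw [← h₁, M.integral_step π θ x (M.measurable_qValue π θ hf hK) (M.abs_qValue_le π θ hK),
    marginal_zero, Kernel.id_apply, pow_zero, one_mul,
    integral_dirac' _ _ hf.stronglyMeasurable]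
  rfl

/-- Links values built from marginals to the trajectory measure. Allowing an arbitrary bounded
reward matters: it is used for `M.reward` and again for the reward Q · ⟨score, v⟩. -/
lemma hasSum_vValue (θ : Param d) (hf : Measurable f) (hK : ∀ x, |f x| ≤ K) (s : S) :
    HasSum (fun t : ℕ => M.discount ^ t * ∫ τ, f (τ t) ∂M.trajFrom π θ s)
      (M.vValue π θ f s) := by
  have h := M.hasSum_integral_qValue π θ hf hK ((Measure.dirac s).prod (π.kernel θ s))
  have h₀ : M.vValue π θ f s =
      ∫ x, M.qValue π θ f x ∂((Measure.dirac s).prod (π.kernel θ s)) := by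
    rw [Measure.dirac_prod, integral_map (by fun_prop)
      (M.measurable_qValue π θ hf hK).aestronglyMeasurable]
    rfl
  rw [h₀]
  convert h using 3 with t
  have hft : Measurable fun τ : ℕ → S × A => f (τ t) := hf.comp (measurable_pi_apply t)
  rw [trajFrom_eq, ← Measure.snd_compProd, Measure.snd,
    integral_map measurable_snd.aemeasurable hft.aestronglyMeasurable,
    Measure.integral_compProd (integrable_of_abs_le (f := fun p : (S × A) × (ℕ → S × A) =>
      f (p.2 t)) (hft.comp measurable_snd) fun _ => hK _)]
  simp only [M.integral_marginal π θ _ _ hf]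

lemma objective_eq_vValue (hK : ∀ x, |M.reward x| ≤ K) (s₀ : S) (θ : Param d) :
    M.objective π s₀ θ = M.vValue π θ M.reward s₀ := by
  rw [objective, value, ← (M.hasSum_vValue π θ M.measurable_reward hK s₀).tsum_eq]
  have hm : ∀ t : ℕ, Measurable fun τ : ℕ → S × A => M.reward (τ t) := fun t =>
    M.measurable_reward.comp (measurable_pi_apply t)
  have h := hasSum_integral_of_summable_integral_norm (μ := M.trajFrom π θ s₀)
    (F := fun (t : ℕ) τ => M.discount ^ t * M.reward (τ t))
    (fun t => (integrable_of_abs_le (hm t) fun _ => hK _).const_mul _) ?_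
  · rw [← h.tsum_eq]
    simp only [integral_const_mul]
  · refine Summable.of_norm_bounded (M.hasSum_discount_mul_const K).summable fun t => ?_
    exact abs_integral_le_of_abs_le fun x => by
      rw [abs_norm]
      exact M.abs_discount_mul_le t (hK _)

end MDP

end RPG

/-! ### Second-order control of a change of policy. -/

namespace RPG

namespace PolicyFamily

variable {d : ℕ} {S A : Type*} [MeasurableSpace S] [MeasurableSpace A]
  {ν : Measure A} {π : PolicyFamily d S ν}

section Score

variable (hπ : ∀ s a, Differentiable ℝ fun θ => π.density θ s a)
include hπ

lemma hasGradientAt_log_density (θ : Param d) (x : S × A) :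
    HasGradientAt (fun η => Real.log (π.density η x.1 x.2)) (π.score θ x) θ :=
  (((hπ x.1 x.2) θ).log (π.density_pos θ x.1 x.2).ne').hasGradientAt

lemma measurable_score (θ : Param d) : Measurable (π.score θ) := by
  have h : ∀ v : Param d, Measurable fun x => inner ℝ (π.score θ x) v := fun v => by
    -- A directional derivative is the limit of difference quotients with increments 1/(n + 1), each
    -- measurable in (s, a).
    refine measurable_of_tendsto_metrizable
      (f := fun (n : ℕ) (x : S × A) => ((n : ℝ) + 1) * (Real.log
        (π.density (θ + ((n : ℝ) + 1)⁻¹ • v) x.1 x.2) - Real.log (π.density θ x.1 x.2)))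
      (fun n => ?_) (tendsto_pi_nhds.2 fun x => ?_)
    · exact (((π.measurable_density _).log).sub ((π.measurable_density _).log)).const_mul _
    · have := (hasGradientAt_log_density hπ θ x).hasFDerivAt.lim v (α := ℕ) (l := atTop)
        (c := fun n => (n : ℝ) + 1) (tendsto_norm_atTop_atTop.comp
          (tendsto_atTop_add_const_right _ _ tendsto_natCast_atTop_atTop))
      simpa using this
  have h' : Measurable fun x => WithLp.ofLp (π.score θ x) := measurable_pi_iff.2 fun i => by
    simpa [EuclideanSpace.inner_single_right] using h (EuclideanSpace.single i 1)
  exact (WithLp.measurable_toLp 2 (Fin d → ℝ)).comp h'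

lemma measurable_score_param {L : ℝ}
    (hL : ∀ x θ₁ θ₂, ‖π.score θ₁ x - π.score θ₂ x‖ ≤ L * ‖θ₁ - θ₂‖) :
    Measurable fun p : Param d × (S × A) => π.score p.1 p.2 := by
  refine measurable_uncurry_of_continuous_of_measurable (u := π.score) (fun x => ?_)
    (measurable_score hπ)
  refine (LipschitzWith.of_dist_le_mul (K := L.toNNReal) fun θ₁ θ₂ => ?_).continuous
  rw [dist_eq_norm, dist_eq_norm]
  exact (hL x θ₁ θ₂).trans (mul_le_mul_of_nonneg_right (Real.le_coe_toNNReal L) (norm_nonneg _))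

lemma abs_log_density_sub_le {B : ℝ} (hB : ∀ x θ, ‖π.score θ x‖ ≤ B) (θ θ' : Param d)
    (x : S × A) :
    |Real.log (π.density θ' x.1 x.2) - Real.log (π.density θ x.1 x.2)| ≤ B * ‖θ' - θ‖ :=
  convex_univ.norm_image_sub_le_of_norm_hasFDerivWithin_le
    (fun η _ => (hasGradientAt_log_density hπ η x).hasFDerivAt.hasFDerivWithinAt)
    (fun η _ => by simpa using hB x η) (Set.mem_univ _) (Set.mem_univ _)

/-- Mean value inequality for the log-density minus its linearization at θ: on the segment, the
derivative of this difference has norm at most L‖θ' - θ‖. -/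
lemma abs_log_density_sub_sub_le {L : ℝ}
    (hL : ∀ x θ₁ θ₂, ‖π.score θ₁ x - π.score θ₂ x‖ ≤ L * ‖θ₁ - θ₂‖) (hL₀ : 0 ≤ L)
    (θ θ' : Param d) (x : S × A) :
    |Real.log (π.density θ' x.1 x.2) - Real.log (π.density θ x.1 x.2) -
      inner ℝ (π.score θ x) (θ' - θ)| ≤ L * ‖θ' - θ‖ ^ 2 := by
  have h := (convex_segment θ θ').norm_image_sub_le_of_norm_hasFDerivWithin_le'
    (φ := InnerProductSpace.toDual ℝ (Param d) (π.score θ x))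
    (C := L * ‖θ' - θ‖)
    (fun η _ => (hasGradientAt_log_density hπ η x).hasFDerivAt.hasFDerivWithinAt)
    (fun η hη => ?_) (left_mem_segment ℝ θ θ') (right_mem_segment ℝ θ θ')
  · rw [pow_two, ← mul_assoc]
    simpa using h
  · rw [← map_sub, LinearIsometryEquiv.norm_map]
    refine (hL x η θ).trans (mul_le_mul_of_nonneg_left ?_ hL₀)
    exact norm_sub_le_of_mem_segment hη

end Score

variable [SigmaFinite ν]

omit [SigmaFinite ν] in
lemma measurable_density_action (θ : Param d) (s : S) : Measurable fun a => π.density θ s a :=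
  (π.measurable_density θ).comp measurable_prodMk_left

omit [SigmaFinite ν] in
lemma measurable_ratio (θ θ' : Param d) (s : S) :
    Measurable fun a => π.density θ' s a / π.density θ s a :=
  (measurable_density_action θ' s).div (measurable_density_action θ s)

/-- Importance sampling: positive densities let expectations under two policies be compared inside
one integral, with no bound on the total mass of ν. -/
lemma kernel_eq_withDensity (θ θ' : Param d) (s : S) :
    π.kernel θ' s = (π.kernel θ s).withDensity
      fun a => ENNReal.ofReal (π.density θ' s a / π.density θ s a) := by
  rw [kernel_apply, kernel_apply, ← withDensity_mul _ (measurable_density_action θ s).ennreal_ofReal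
    (measurable_ratio θ θ' s).ennreal_ofReal]
  congr 1
  funext a
  rw [Pi.mul_apply, ← ENNReal.ofReal_mul (π.density_pos θ s a).le,
    mul_div_cancel₀ _ (π.density_pos θ s a).ne']

lemma integral_kernel_change (θ θ' : Param d) (s : S) (g : A → ℝ) :
    ∫ a, g a ∂π.kernel θ' s = ∫ a, π.density θ' s a / π.density θ s a * g a ∂π.kernel θ s := by
  rw [kernel_eq_withDensity θ θ', integral_withDensity_eq_integral_toReal_smul
    (measurable_ratio θ θ' s).ennreal_ofReal (ae_of_all _ fun a => ENNReal.ofReal_lt_top)]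
  simp only [smul_eq_mul, ENNReal.toReal_ofReal
    (div_nonneg (π.density_pos θ' s _).le (π.density_pos θ s _).le)]

lemma integrable_ratio_mul (θ θ' : Param d) (s : S) {g : A → ℝ}
    (hg : Integrable g (π.kernel θ' s)) :
    Integrable (fun a => π.density θ' s a / π.density θ s a * g a) (π.kernel θ s) := by
  rw [kernel_eq_withDensity θ θ', integrable_withDensity_iff_integrable_smul'
    (measurable_ratio θ θ' s).ennreal_ofReal (ae_of_all _ fun a => ENNReal.ofReal_lt_top)] at hg
  simpa only [smul_eq_mul, ENNReal.toReal_ofReal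
    (div_nonneg (π.density_pos θ' s _).le (π.density_pos θ s _).le)] using hg

variable (hπ : ∀ s a, Differentiable ℝ fun θ => π.density θ s a)
  {B : ℝ} (hB : ∀ x θ, ‖π.score θ x‖ ≤ B) {f : S × A → ℝ} (hf : Measurable f) {K : ℝ}
  (hK : ∀ x, |f x| ≤ K)
include hπ hB hf hK

/-- Expectations of bounded functions under the policy are Lipschitz in the parameter. -/
lemma abs_integral_kernel_sub_le (hB₀ : 0 ≤ B) (θ θ' : Param d) (s : S) :
    |∫ a, f (s, a) ∂π.kernel θ' s - ∫ a, f (s, a) ∂π.kernel θ s| ≤ 2 * B * K * ‖θ' - θ‖ := by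
  have hfs : Measurable fun a => f (s, a) := hf.comp measurable_prodMk_left
  have hK₀ : 0 ≤ K := by
    obtain ⟨a⟩ := (π.kernel θ s).nonempty_of_neZero
    exact (abs_nonneg _).trans (hK (s, a))
  -- For log-ratios |u| ≤ 1, |exp u - 1| ≤ 2|u|. For distant parameters the trivial bound 2K is
  -- already at most 2BK‖θ' - θ‖.
  rcases le_or_gt (B * ‖θ' - θ‖) 1 with h | h
  · rw [integral_kernel_change θ θ', ← integral_sub
      (integrable_ratio_mul θ θ' s (integrable_of_abs_le hfs fun _ => hK _))
      (integrable_of_abs_le hfs fun _ => hK _)]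
    refine abs_integral_le_of_abs_le fun a => ?_
    have hu := abs_log_density_sub_le hπ hB θ θ' (s, a)
    dsimp only at hu
    set u := Real.log (π.density θ' s a) - Real.log (π.density θ s a)
    have hr : π.density θ' s a / π.density θ s a = Real.exp u := by
      rw [Real.exp_sub, Real.exp_log (π.density_pos _ _ _), Real.exp_log (π.density_pos _ _ _)]
    rw [hr, show Real.exp u * f (s, a) - f (s, a) = (Real.exp u - 1) * f (s, a) by ring, abs_mul]
    calc |Real.exp u - 1| * |f (s, a)| ≤ (2 * (B * ‖θ' - θ‖)) * K := by
          refine mul_le_mul ?_ (hK _) (abs_nonneg _) (by positivity)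
          exact (Real.abs_exp_sub_one_le (hu.trans h)).trans (by linarith)
      _ = 2 * B * K * ‖θ' - θ‖ := by ring
  · have h₁ := abs_integral_le_of_abs_le (μ := π.kernel θ s) fun a => hK (s, a)
    have h₂ := abs_integral_le_of_abs_le (μ := π.kernel θ' s) fun a => hK (s, a)
    refine (abs_sub _ _).trans ?_
    nlinarith

/-- First-order expansion, with quadratic remainder, of expectations of bounded functions under
the policy. -/
lemma abs_integral_kernel_sub_sub_le {L : ℝ}
    (hL : ∀ x θ₁ θ₂, ‖π.score θ₁ x - π.score θ₂ x‖ ≤ L * ‖θ₁ - θ₂‖) (hL₀ : 0 ≤ L)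
    (θ θ' : Param d) (s : S) :
    |∫ a, f (s, a) ∂π.kernel θ' s - ∫ a, f (s, a) ∂π.kernel θ s -
      ∫ a, f (s, a) * inner ℝ (π.score θ (s, a)) (θ' - θ) ∂π.kernel θ s| ≤
      (3 * B ^ 2 + L) * K * ‖θ' - θ‖ ^ 2 := by
  have hfs : Measurable fun a => f (s, a) := hf.comp measurable_prodMk_left
  have hK₀ : 0 ≤ K := by
    obtain ⟨a⟩ := (π.kernel θ s).nonempty_of_neZero
    exact (abs_nonneg _).trans (hK (s, a))
  have hin : ∀ a, |f (s, a) * inner ℝ (π.score θ (s, a)) (θ' - θ)| ≤ K * (B * ‖θ' - θ‖) :=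
    fun a => by
      rw [abs_mul]
      refine mul_le_mul (hK _) ((abs_real_inner_le_norm _ _).trans ?_) (abs_nonneg _) hK₀
      exact mul_le_mul_of_nonneg_right (hB _ _) (norm_nonneg _)
  -- Nearby, exp u - 1 - v = (exp u - 1 - u) + (u - v) costs only B² + L. The factor 3 comes from
  -- the far case, where the three integrals are bounded by K, K and K(B‖θ' - θ‖), each at most
  -- K(B‖θ' - θ‖)².
  rcases le_or_gt (B * ‖θ' - θ‖) 1 with h | h
  · have hmi : Measurable fun a => f (s, a) * inner ℝ (π.score θ (s, a)) (θ' - θ) :=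
      hfs.mul (((measurable_score hπ θ).comp measurable_prodMk_left).inner measurable_const)
    have hi₁ := integrable_ratio_mul θ θ' s
      (integrable_of_abs_le (μ := π.kernel θ' s) hfs fun _ => hK _)
    have hi₂ : Integrable (fun a => f (s, a)) (π.kernel θ s) :=
      integrable_of_abs_le hfs fun _ => hK _
    have hi₁₂ : Integrable (fun a => π.density θ' s a / π.density θ s a * f (s, a) - f (s, a))
      (π.kernel θ s) := hi₁.sub hi₂
    rw [integral_kernel_change θ θ', ← integral_sub hi₁ hi₂,
      ← integral_sub hi₁₂ (integrable_of_abs_le hmi hin)]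
    refine abs_integral_le_of_abs_le fun a => ?_
    have hu := abs_log_density_sub_le hπ hB θ θ' (s, a)
    have hv := abs_log_density_sub_sub_le hπ hL hL₀ θ θ' (s, a)
    dsimp only at hu hv
    set u := Real.log (π.density θ' s a) - Real.log (π.density θ s a)
    set v : ℝ := inner ℝ (π.score θ (s, a)) (θ' - θ)
    have hr : π.density θ' s a / π.density θ s a = Real.exp u := by
      rw [Real.exp_sub, Real.exp_log (π.density_pos _ _ _), Real.exp_log (π.density_pos _ _ _)]
    have he : |Real.exp u - 1 - u| ≤ (B * ‖θ' - θ‖) ^ 2 :=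
      (Real.abs_exp_sub_one_sub_id_le (hu.trans h)).trans
        (sq_le_sq' (abs_le.1 hu).1 (abs_le.1 hu).2)
    have ht : |Real.exp u - 1 - v| ≤ (3 * B ^ 2 + L) * ‖θ' - θ‖ ^ 2 := by
      have := abs_add_le (Real.exp u - 1 - u) (u - v)
      rw [sub_add_sub_cancel] at this
      nlinarith [sq_nonneg (B * ‖θ' - θ‖)]
    rw [hr, show Real.exp u * f (s, a) - f (s, a) - f (s, a) * v =
      (Real.exp u - 1 - v) * f (s, a) by ring, abs_mul]
    calc |Real.exp u - 1 - v| * |f (s, a)| ≤ ((3 * B ^ 2 + L) * ‖θ' - θ‖ ^ 2) * K :=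
          mul_le_mul ht (hK _) (abs_nonneg _) (by positivity)
      _ = _ := by ring
  · have h₁ := abs_integral_le_of_abs_le (μ := π.kernel θ s) fun a => hK (s, a)
    have h₂ := abs_integral_le_of_abs_le (μ := π.kernel θ' s) fun a => hK (s, a)
    have h₃ := abs_integral_le_of_abs_le (μ := π.kernel θ s) hin
    refine (abs_sub _ _).trans ((add_le_add_left (abs_sub _ _) _).trans ?_)
    have h₄ : 1 ≤ (B * ‖θ' - θ‖) ^ 2 := one_le_pow₀ h.le
    have h₅ : B * ‖θ' - θ‖ ≤ (B * ‖θ' - θ‖) ^ 2 := by nlinarith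
    have h₆ : 0 ≤ L * K * ‖θ' - θ‖ ^ 2 := by positivity
    nlinarith [mul_le_mul_of_nonneg_left h₄ hK₀, mul_le_mul_of_nonneg_left h₅ hK₀]

end PolicyFamily

end RPG

/-! ### First-order expansion of the value function. -/

/-- A bounded function satisfying a contraction inequality for all its bounds is bounded by the
corresponding fixed point. -/
lemma abs_le_of_contraction {α : Type*} {γ : ℝ} (hγ : γ < 1) {D : α → ℝ} {K c : ℝ}
    (hK : ∀ s, |D s| ≤ K)
    (h : ∀ b, (∀ s, |D s| ≤ b) → ∀ s, |D s| ≤ c + γ * b) (s : α) :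
    |D s| ≤ c / (1 - γ) := by
  have hbdd : BddAbove (Set.range fun s => |D s|) := ⟨K, by rintro _ ⟨s, rfl⟩; exact hK s⟩
  have hle : ∀ s, |D s| ≤ ⨆ s, |D s| := fun s => le_ciSup hbdd s
  have : Nonempty α := ⟨s⟩
  have hsup : (⨆ s, |D s|) ≤ c + γ * ⨆ s, |D s| := ciSup_le (h _ hle)
  rw [le_div_iff₀ (by linarith)]
  nlinarith [hle s]

namespace RPG

namespace MDP

variable {d : ℕ} {S A : Type*} [MeasurableSpace S] [MeasurableSpace A]
  {ν : Measure A} [SigmaFinite ν] (M : MDP S A) {π : PolicyFamily d S ν}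

section Expansion

variable (hπ : ∀ s a, Differentiable ℝ fun θ => π.density θ s a)
  {B : ℝ} (hB : ∀ x θ, ‖π.score θ x‖ ≤ B) (hB₀ : 0 ≤ B)
  {f : S × A → ℝ} (hf : Measurable f) {U : ℝ} (hU : ∀ x, |f x| ≤ U)
include hπ hB hf hU

omit [SigmaFinite ν] hπ hf hU in
lemma abs_mul_inner_score_le {g : S × A → ℝ} {K : ℝ} (hK : ∀ x, |g x| ≤ K) (θ v : Param d)
    (x : S × A) : |g x * inner ℝ (π.score θ x) v| ≤ K * (B * ‖v‖) := by
  rw [abs_mul]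
  refine mul_le_mul (hK _) ((abs_real_inner_le_norm _ _).trans ?_) (abs_nonneg _)
    ((abs_nonneg _).trans (hK x))
  exact mul_le_mul_of_nonneg_right (hB _ _) (norm_nonneg _)

omit hB in
lemma measurable_qValue_mul_inner (θ v : Param d) :
    Measurable fun x => M.qValue π θ f x * inner ℝ (π.score θ x) v :=
  (M.measurable_qValue π θ hf hU).mul ((PolicyFamily.measurable_score hπ θ).inner measurable_const)

include hB₀ in
/-- First-order expansion of the value function in the policy parameter, with a uniform quadratic
remainder. -/
lemma abs_vValue_sub_sub_le {L : ℝ}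
    (hL : ∀ x θ₁ θ₂, ‖π.score θ₁ x - π.score θ₂ x‖ ≤ L * ‖θ₁ - θ₂‖) (hL₀ : 0 ≤ L)
    (θ θ' : Param d) (s : S) :
    |M.vValue π θ' f s - M.vValue π θ f s -
      M.vValue π θ (fun x => M.qValue π θ f x * inner ℝ (π.score θ x) (θ' - θ)) s| ≤
      ((3 * B ^ 2 + L) * (U / (1 - M.discount)) + M.discount *
        (2 * B * (U / (1 - M.discount) * B / (1 - M.discount)))) / (1 - M.discount) *
          ‖θ' - θ‖ ^ 2 := by
  have hγ₀ := M.discount_pos.le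
  have hγ₁ : 0 < 1 - M.discount := by linarith [M.discount_lt_one]
  set K := U / (1 - M.discount)
  set δ := ‖θ' - θ‖
  set g : S × A → ℝ := fun x => M.qValue π θ f x * inner ℝ (π.score θ x) (θ' - θ)
  have hQ := M.measurable_qValue π θ hf hU
  have hQK := M.abs_qValue_le π θ hU
  have hg : Measurable g := M.measurable_qValue_mul_inner hπ hf hU θ (θ' - θ)
  have hgK : ∀ x, |g x| ≤ K * (B * δ) := abs_mul_inner_score_le hB hQK θ (θ' - θ)
  have hV := M.measurable_vValue π θ hf hU
  have hV' := M.measurable_vValue π θ' hf hU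
  have hVg := M.measurable_vValue π θ hg hgK
  have bV := M.abs_vValue_le π θ hU
  have bV' := M.abs_vValue_le π θ' hU
  have bVg := M.abs_vValue_le π θ hgK
  set D : S → ℝ := fun s => M.vValue π θ' f s - M.vValue π θ f s - M.vValue π θ g s with hD
  have hDm : Measurable D := (hV'.sub hV).sub hVg
  have hDb : ∀ s, |D s| ≤ K + K + K * (B * δ) / (1 - M.discount) := fun s =>
    (abs_sub _ _).trans (add_le_add ((abs_sub _ _).trans (add_le_add (bV' s) (bV s))) (bVg s))
  set h : S × A → ℝ := fun x => ∫ s, M.vValue π θ g s ∂M.trans x with hh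
  set e : S × A → ℝ := fun x => ∫ s, D s ∂M.trans x with he
  have hhm : Measurable h := hVg.stronglyMeasurable.integral_kernel.measurable
  have hem : Measurable e := hDm.stronglyMeasurable.integral_kernel.measurable
  have hhb : ∀ x, |h x| ≤ K * (B * δ) / (1 - M.discount) := fun x => abs_integral_le_of_abs_le bVg
  have heb : ∀ b, (∀ s, |D s| ≤ b) → ∀ x, |e x| ≤ b := fun b hb x => abs_integral_le_of_abs_le hb
  -- The two Bellman equations share the immediate reward, so the action values differ only through
  -- the next-state values, whose difference is D plus the value of g.
  have hQ' : ∀ x, M.qValue π θ' f x = M.qValue π θ f x + M.discount * e x + M.discount * h x := by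
    intro x
    rw [M.qValue_eq π θ' hf hU, M.qValue_eq π θ hf hU]
    have i₁ := integrable_of_abs_le (μ := M.trans x) hV bV
    have i₂ := integrable_of_abs_le (μ := M.trans x) hV' bV'
    have i₃ := integrable_of_abs_le (μ := M.trans x) hVg bVg
    have : e x = ∫ s, M.vValue π θ' f s ∂M.trans x - ∫ s, M.vValue π θ f s ∂M.trans x - h x := by
      rw [he, hD, hh]
      dsimp only
      rw [← integral_sub i₂ i₁]
      exact integral_sub (i₂.sub i₁) i₃
    rw [this]; ring
  -- Three contributions: the policy expansion for fixed Q, of order δ²; the remainder carried one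
  -- step further, the contractive term; and a change of policy applied to `h`. As `h` is itself
  -- O(δ), a first-order bound makes the last term O(δ²).
  have hfix : ∀ s, D s =
      (∫ a, M.qValue π θ f (s, a) ∂π.kernel θ' s - ∫ a, M.qValue π θ f (s, a) ∂π.kernel θ s -
        ∫ a, g (s, a) ∂π.kernel θ s) + M.discount * ∫ a, e (s, a) ∂π.kernel θ' s +
      M.discount * (∫ a, h (s, a) ∂π.kernel θ' s - ∫ a, h (s, a) ∂π.kernel θ s) := by
    intro s
    have int : ∀ {η : Param d} {w : S × A → ℝ} {b : ℝ}, Measurable w → (∀ x, |w x| ≤ b) →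
        Integrable (fun a => w (s, a)) (π.kernel η s) := fun hw hb =>
      integrable_of_abs_le (hw.comp measurable_prodMk_left) fun _ => hb _
    have v₁ : M.vValue π θ' f s = ∫ a, M.qValue π θ f (s, a) ∂π.kernel θ' s +
        M.discount * ∫ a, e (s, a) ∂π.kernel θ' s +
        M.discount * ∫ a, h (s, a) ∂π.kernel θ' s := by
      rw [vValue]
      simp only [hQ']
      rw [integral_add, integral_add, integral_const_mul, integral_const_mul]
      · exact int hQ hQK
      · exact (int hem (heb _ hDb)).const_mul _
      · exact (int hQ hQK).add ((int hem (heb _ hDb)).const_mul _)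
      · exact (int hhm hhb).const_mul _
    have v₂ : M.vValue π θ g s = ∫ a, g (s, a) ∂π.kernel θ s +
        M.discount * ∫ a, h (s, a) ∂π.kernel θ s := by
      rw [vValue]
      simp only [M.qValue_eq π θ hg hgK]
      rw [integral_add, integral_const_mul]
      · exact int hg hgK
      · exact (int hhm hhb).const_mul _
    rw [hD]
    dsimp only
    rw [v₁, v₂, vValue]
    ring
  refine (abs_le_of_contraction (c := ((3 * B ^ 2 + L) * K + M.discount *
    (2 * B * (K * B / (1 - M.discount)))) * δ ^ 2) M.discount_lt_one hDb
    (fun b hb s => ?_) s).trans_eq (by ring)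
  have t₁ := PolicyFamily.abs_integral_kernel_sub_sub_le hπ hB hQ hQK hL hL₀ θ θ' s
  have t₂ := PolicyFamily.abs_integral_kernel_sub_le hπ hB hhm hhb hB₀ θ θ' s
  have t₃ := abs_integral_le_of_abs_le (μ := π.kernel θ' s) fun a => heb b hb (s, a)
  rw [hfix]
  calc _ ≤ (3 * B ^ 2 + L) * K * δ ^ 2 + M.discount * b +
        M.discount * (2 * B * (K * (B * δ) / (1 - M.discount)) * δ) := by
        refine (abs_add_le _ _).trans (add_le_add ((abs_add_le _ _).trans (add_le_add t₁ ?_)) ?_)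
        · rw [abs_mul, abs_of_nonneg hγ₀]
          exact mul_le_mul_of_nonneg_left t₃ hγ₀
        · rw [abs_mul, abs_of_nonneg hγ₀]
          exact mul_le_mul_of_nonneg_left t₂ hγ₀
    _ = _ := by ring

end Expansion

/-! ### Unbiasedness of the random-horizon gradient estimate. -/

section MeanGradient

lemma outerHorizon_integral (f : ℕ → ℝ) :
    ∫ n, f n ∂M.outerHorizon = (1 - M.discount) * ∑' n : ℕ, M.discount ^ n * f n := by
  rw [outerHorizon, integral_geometricMeasure, ← tsum_mul_left]
  · refine tsum_congr fun n => ?_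
    simp only [sub_sub_cancel, smul_eq_mul]
    ring
  · intro h
    have := congrArg Subtype.val h
    have h' : 1 - M.discount = 0 := this
    linarith [M.discount_lt_one]

lemma sqrt_discount_lt_one : √M.discount < 1 :=
  (Real.sqrt_lt' one_pos).2 (by simpa using M.discount_lt_one)

lemma innerHorizon_integral (f : ℕ → ℝ) :
    ∫ n, f n ∂M.innerHorizon = (1 - √M.discount) * ∑' n : ℕ, √M.discount ^ n * f n := by
  rw [innerHorizon, integral_geometricMeasure, ← tsum_mul_left]
  · refine tsum_congr fun n => ?_
    simp only [sub_sub_cancel, smul_eq_mul]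
    ring
  · intro h
    have := congrArg Subtype.val h
    have h' : 1 - √M.discount = 0 := this
    linarith [M.sqrt_discount_lt_one]

lemma measurable_estQ : Measurable (M.estQ : Rollout S A → ℝ) := by
  refine measurable_from_prod_countable_right fun n => ?_
  exact Finset.measurable_fun_sum (Finset.range (n + 1)) fun t _ =>
    (M.measurable_reward.comp (measurable_pi_apply t)).const_mul (√M.discount ^ t)

variable {U : ℝ} (hU : ∀ x, |M.reward x| ≤ U)
include hU

lemma abs_estQ_le (x : Rollout S A) : |M.estQ x| ≤ U / (1 - √M.discount) := by
  have hr := Real.sqrt_nonneg M.discount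
  have hU₀ : 0 ≤ U := (abs_nonneg _).trans (hU (x.2 0))
  have hs := (hasSum_geometric_of_lt_one hr M.sqrt_discount_lt_one).mul_right U
  rw [div_eq_inv_mul, ← hs.tsum_eq]
  refine (Finset.abs_sum_le_sum_abs _ _).trans ((Finset.sum_le_sum fun t _ => ?_).trans
    (hs.summable.sum_le_tsum (Finset.range (x.1 + 1)) fun t _ => by positivity))
  rw [abs_mul, abs_of_nonneg (pow_nonneg hr t)]
  exact mul_le_mul_of_nonneg_left (hU _) (pow_nonneg hr t)

variable (π) in
/-- The randomly truncated return is an unbiased estimate of the action-value function. -/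
lemma integral_estQ (θ : Param d) (x : S × A) :
    ∫ y, M.estQ y ∂(M.innerHorizon.prod (M.trajKernel π θ x)) = M.qValue π θ M.reward x := by
  have hr := Real.sqrt_nonneg M.discount
  have hr₁ : 0 < 1 - √M.discount := by linarith [M.sqrt_discount_lt_one]
  set m : ℕ → ℝ := fun t => ∫ y, M.reward y ∂M.marginal π θ t x with hm
  have hmU : ∀ t, |m t| ≤ U := fun t => abs_integral_le_of_abs_le hU
  have hi : ∀ t : ℕ, Integrable (fun τ : ℕ → S × A => M.reward (τ t)) (M.trajKernel π θ x) :=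
    fun t => integrable_of_abs_le (M.measurable_reward.comp (measurable_pi_apply t)) fun _ => hU _
  rw [integral_prod _ (integrable_of_abs_le M.measurable_estQ (M.abs_estQ_le hU)),
    innerHorizon_integral]
  -- For t ≤ n, γ^(n/2) γ^(t/2) = γ^t γ^((n-t)/2). Summing over n gives the Cauchy product of the
  -- series for Q with a geometric series in √γ, whose sum cancels the horizon weight 1 - √γ.
  have h₁ : ∀ n : ℕ, √M.discount ^ n * ∫ τ, M.estQ (n, τ) ∂M.trajKernel π θ x =
      ∑ t ∈ Finset.range (n + 1), (M.discount ^ t * m t) * √M.discount ^ (n - t) := fun n => by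
    unfold estQ
    dsimp only
    rw [integral_finsetSum _ fun t _ => (hi t).const_mul _, Finset.mul_sum]
    refine Finset.sum_congr rfl fun t ht => ?_
    have htn : t ≤ n := Nat.lt_succ_iff.1 (Finset.mem_range.1 ht)
    rw [integral_const_mul, hm]
    dsimp only
    rw [M.integral_marginal π θ t x M.measurable_reward]
    nth_rw 1 [← Nat.sub_add_cancel htn]
    nth_rw 3 [← Real.sq_sqrt M.discount_pos.le]
    rw [pow_add]
    ring
  have h₂ : Summable fun t : ℕ => ‖M.discount ^ t * m t‖ :=
    (Summable.of_nonneg_of_le (fun _ => norm_nonneg _)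
      (fun t => M.abs_discount_mul_le t (hmU t)) (M.hasSum_discount_mul_const U).summable)
  have h₃ : Summable fun t : ℕ => ‖√M.discount ^ t‖ :=
    (summable_geometric_of_lt_one hr M.sqrt_discount_lt_one).norm
  simp only [h₁]
  rw [← tsum_mul_tsum_eq_tsum_sum_range_of_summable_norm h₂ h₃,
    tsum_geometric_of_lt_one hr M.sqrt_discount_lt_one, qValue]
  field_simp
  rfl

variable {B : ℝ} (hB : ∀ x θ, ‖π.score θ x‖ ≤ B)

include hB in
omit [SigmaFinite ν] in
lemma norm_gradEst_le (θ : Param d) (x : Rollout S A × Rollout S A) :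
    ‖M.gradEst π θ x‖ ≤ (1 - M.discount)⁻¹ * (U / (1 - √M.discount)) * B := by
  have h₁ : 0 < 1 - M.discount := by linarith [M.discount_lt_one]
  have h₂ := M.abs_estQ_le hU x.2
  rw [gradEst, norm_smul, Real.norm_eq_abs, abs_mul, abs_of_pos (inv_pos.2 h₁)]
  exact mul_le_mul (mul_le_mul_of_nonneg_left h₂ (inv_pos.2 h₁).le) (hB _ _) (norm_nonneg _)
    (mul_nonneg (inv_pos.2 h₁).le ((abs_nonneg _).trans h₂))

variable (hπ : ∀ s a, Differentiable ℝ fun θ => π.density θ s a)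
include hπ

omit hU [SigmaFinite ν] in
lemma measurable_gradEst (θ : Param d) : Measurable (M.gradEst π θ) :=
  ((M.measurable_estQ.comp measurable_snd).const_mul _).smul
    ((PolicyFamily.measurable_score hπ θ).comp (Rollout.measurable_last.comp measurable_fst))

omit hU [SigmaFinite ν] in
lemma measurable_gradEst_param {L : ℝ}
    (hL : ∀ x θ₁ θ₂, ‖π.score θ₁ x - π.score θ₂ x‖ ≤ L * ‖θ₁ - θ₂‖) :
    Measurable fun p : Param d × (Rollout S A × Rollout S A) => M.gradEst π p.1 p.2 :=
  ((M.measurable_estQ.comp (measurable_snd.comp measurable_snd)).const_mul _).smul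
    (Measurable.comp (g := fun p : Param d × (S × A) => π.score p.1 p.2)
      (f := fun p : Param d × (Rollout S A × Rollout S A) => (p.1, p.2.1.last))
      (PolicyFamily.measurable_score_param hπ hL)
      (measurable_fst.prodMk (Rollout.measurable_last.comp (measurable_fst.comp measurable_snd))))

include hB

/-- The policy gradient theorem for the random-horizon estimate: its mean, tested against `v`, is
the first-order coefficient of the value function in direction `v`. -/
lemma inner_integral_gradEst (s₀ : S) (θ v : Param d) :
    inner ℝ (∫ x, M.gradEst π θ x ∂M.iterationLaw π s₀ θ) v =
      M.vValue π θ (fun x => M.qValue π θ M.reward x * inner ℝ (π.score θ x) v) s₀ := by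
  have hγ₁ : 0 < 1 - M.discount := by linarith [M.discount_lt_one]
  have hgi : Integrable (M.gradEst π θ) (M.iterationLaw π s₀ θ) :=
    Integrable.of_bound (M.measurable_gradEst hπ θ).aestronglyMeasurable _
      (ae_of_all _ (M.norm_gradEst_le hU hB θ))
  set F : S × A → ℝ := fun x => M.qValue π θ M.reward x * inner ℝ (π.score θ x) v
  have hF : Measurable F := M.measurable_qValue_mul_inner hπ M.measurable_reward hU θ v
  have hFb : ∀ x, |F x| ≤ _ :=
    abs_mul_inner_score_le hB (M.abs_qValue_le π θ hU) θ v
  rw [real_inner_comm, ← integral_inner hgi]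
  have hgi' := hgi.const_inner v (𝕜 := ℝ)
  unfold iterationLaw at hgi' ⊢
  rw [Measure.integral_compProd hgi']
  -- The score depends only on the first rollout, so integrating out the second replaces the
  -- estimate by Q at the last pair.
  have h₁ : ∀ x : Rollout S A, ∫ y, inner ℝ v (M.gradEst π θ (x, y))
      ∂(Kernel.const (Rollout S A) M.innerHorizon ×ₖ
        (M.trajKernel π θ).comap Rollout.last Rollout.measurable_last) x =
      (1 - M.discount)⁻¹ * F x.last := fun x => by
    rw [Kernel.prod_apply, Kernel.const_apply, Kernel.comap_apply]
    simp only [gradEst, inner_smul_right]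
    rw [integral_mul_const, integral_const_mul, M.integral_estQ π hU, real_inner_comm]
    ring
  simp only [h₁]
  -- Averaging F(s_T, a_T) over T with weights (1 - γ)γ^t gives 1 - γ times the discounted value of
  -- F as a reward; the factor (1 - γ)⁻¹ of the estimate cancels it.
  rw [integral_const_mul, integral_prod _ (integrable_of_abs_le
    (f := fun x : Rollout S A => F x.last) (hF.comp Rollout.measurable_last) fun _ => hFb _), outerHorizon_integral,
    inv_mul_cancel_left₀ hγ₁.ne']
  exact (M.hasSum_vValue π θ hF hFb s₀).tsum_eq

end MeanGradient

end MDP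

end RPG

/-! ### Consequences of a uniform quadratic expansion. -/

section QuadraticExpansion

variable {E : Type*} [NormedAddCommGroup E] [InnerProductSpace ℝ E] {J : E → ℝ} {G : E → E} {C : ℝ}

/-- A uniform first-order expansion with quadratic remainder forces the first-order coefficient to
be Lipschitz. -/
lemma norm_sub_le_of_quadratic_expansion
    (h : ∀ x y, |J y - J x - inner ℝ (G x) (y - x)| ≤ C * ‖y - x‖ ^ 2) (x y : E) :
    ‖G y - G x‖ ≤ 6 * C * ‖y - x‖ := by
  rcases eq_or_ne y x with rfl | hxy
  · simp
  have hn : 0 < ‖y - x‖ := norm_pos_iff.2 (sub_ne_zero.2 hxy)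
  have hC : 0 ≤ C := by
    have := (abs_nonneg _).trans (h x y)
    exact nonneg_of_mul_nonneg_left this (by positivity)
  rcases eq_or_ne (G y - G x) 0 with hw | hw
  · rw [hw, norm_zero]; positivity
  have hwn : 0 < ‖G y - G x‖ := norm_pos_iff.2 hw
  set w := G y - G x with hwd
  -- The test vector points along w with length ‖y - x‖. Comparing the expansions y → y + u, x → y +
  -- u and x → y costs C + 4C + C, whence the constant 6C.
  set u := (‖y - x‖ / ‖w‖) • w with hu
  have hun : ‖u‖ = ‖y - x‖ := by
    rw [hu, norm_smul, norm_div, norm_norm, norm_norm, div_mul_cancel₀ _ hwn.ne']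
  have hwu : inner ℝ w u = ‖y - x‖ * ‖w‖ := by
    rw [hu, inner_smul_right, real_inner_self_eq_norm_sq]
    field_simp
  have h₁ := h y (y + u)
  have h₂ := h x (y + u)
  have h₃ := h x y
  rw [add_sub_cancel_left, hun] at h₁
  have h₄ : ‖y + u - x‖ ≤ 2 * ‖y - x‖ := by
    rw [add_sub_right_comm]
    exact (norm_add_le _ _).trans (by rw [hun]; linarith)
  have h₅ : ‖y + u - x‖ ^ 2 ≤ 4 * ‖y - x‖ ^ 2 := by
    nlinarith [norm_nonneg (y + u - x)]
  have h₆ : inner ℝ (G x) (y + u - x) = inner ℝ (G x) (y - x) + inner ℝ (G x) u := by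
    rw [← inner_add_right, add_sub_right_comm]
  have h₇ : inner ℝ w u = inner ℝ (G y) u - inner ℝ (G x) u := by rw [hwd, inner_sub_left]
  have h₈ : ‖y - x‖ * ‖w‖ ≤ ‖y - x‖ * (6 * C * ‖y - x‖) := by
    rw [← hwu, h₇]
    rw [h₆] at h₂
    have := mul_le_mul_of_nonneg_left h₅ hC
    linarith [(abs_le.1 h₁).1, (abs_le.1 h₂).2, (abs_le.1 h₃).1]
  exact le_of_mul_le_mul_left h₈ hn

lemma hasGradientAt_of_quadratic_expansion [CompleteSpace E]
    (h : ∀ x y, |J y - J x - inner ℝ (G x) (y - x)| ≤ C * ‖y - x‖ ^ 2) (x : E) :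
    HasGradientAt J (G x) x := by
  rw [hasGradientAt_iff_isLittleO]
  refine Asymptotics.IsBigO.trans_isLittleO (g := fun y => ‖y - x‖ ^ 2) ?_
    (Asymptotics.isLittleO_pow_sub_sub x one_lt_two)
  exact Asymptotics.IsBigO.of_bound C (Eventually.of_forall fun y => by
    simpa using h x y)

lemma continuous_of_quadratic_expansion
    (h : ∀ x y, |J y - J x - inner ℝ (G x) (y - x)| ≤ C * ‖y - x‖ ^ 2) : Continuous G := by
  refine (LipschitzWith.of_dist_le_mul (K := (6 * C).toNNReal) fun y x => ?_).continuous
  rw [dist_eq_norm, dist_eq_norm]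
  exact (norm_sub_le_of_quadratic_expansion h x y).trans
    (mul_le_mul_of_nonneg_right (Real.le_coe_toNNReal _) (norm_nonneg _))

end QuadraticExpansion

/-! ### Pathwise convergence of a perturbed gradient recursion. -/

/-- A perturbed gradient recursion with divergent stepsizes, summable noise and
`∑ α_k ‖G(θ_k)‖² < ∞` satisfies `‖G(θ_k)‖ → 0`. -/
lemma tendsto_norm_zero_of_perturbed_recursion {E : Type*} [NormedAddCommGroup E] [NormedSpace ℝ E]
    {G : E → E} {L : ℝ} (hG : ∀ x y, ‖G y - G x‖ ≤ L * ‖y - x‖) {α : ℕ → ℝ} (hα₀ : ∀ k, 0 ≤ α k)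
    (hα : Tendsto (fun n => ∑ k ∈ Finset.range n, α k) atTop atTop) {θ e : ℕ → E}
    (hθ : ∀ k, θ (k + 1) = θ k + α k • G (θ k) + e k)
    (he : CauchySeq fun n => ∑ k ∈ Finset.range n, e k)
    (hs : Summable fun k => α k * ‖G (θ k)‖ ^ 2) :
    Tendsto (fun k => ‖G (θ k)‖) atTop (𝓝 0) := by
  set L' := |L| + 1
  have hL' : 0 < L' := by positivity
  have hG' : ∀ x y, ‖G y - G x‖ ≤ L' * ‖y - x‖ := fun x y =>
    (hG x y).trans (mul_le_mul_of_nonneg_right ((le_abs_self L).trans (by linarith))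
      (norm_nonneg _))
  rw [Metric.tendsto_atTop]
  intro ε' hε'
  obtain ⟨ε, hε, rfl⟩ : ∃ ε, 0 < ε ∧ ε' = 2 * ε := ⟨ε' / 2, by positivity, by ring⟩
  obtain ⟨N₁, hN₁⟩ := Metric.cauchySeq_iff.1 he (ε / (4 * L')) (by positivity)
  obtain ⟨N₂, hN₂⟩ := Metric.cauchySeq_iff.1 hs.hasSum.tendsto_sum_nat.cauchySeq
    (ε ^ 2 / (4 * L')) (by positivity)
  refine ⟨max N₁ N₂, fun m hm => ?_⟩
  rw [dist_zero_right, norm_norm]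
  by_contra! hbig
  -- If ‖G‖ stayed above ε from time m on, summability of α_k‖G(θ_k)‖² would make ∑ α_k converge.
  have hex : ∃ n, m ≤ n ∧ ‖G (θ n)‖ ≤ ε := by
    by_contra! hno
    refine not_summable_iff_tendsto_nat_atTop_of_nonneg hα₀ |>.2 hα ?_
    rw [← summable_nat_add_iff m]
    have h := ((summable_nat_add_iff m).2 hs).mul_left (ε ^ 2)⁻¹
    refine Summable.of_nonneg_of_le (fun k => hα₀ _) (fun k => ?_) h
    rw [le_inv_mul_iff₀ (by positivity), mul_comm]
    exact mul_le_mul_of_nonneg_left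
      (pow_le_pow_left₀ hε.le (hno (k + m) (Nat.le_add_left m k)).le 2) (hα₀ _)
  classical
  obtain ⟨hmn, hn⟩ := Nat.find_spec hex
  -- Before the first return time n one has ‖G‖ > ε, so α‖G‖ ≤ ε⁻¹ α‖G‖². Drift and noise then each
  -- move θ by at most ε/(4L'), and G by at most ε/2 in all, too little for a drop from 2ε to ε.
  set n := Nat.find hex
  have hlt : ∀ k ∈ Finset.Ico m n, ε < ‖G (θ k)‖ := fun k hk => by
    have := Nat.find_min hex (Finset.mem_Ico.1 hk).2
    push Not at this
    exact this (Finset.mem_Ico.1 hk).1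
  have htel : θ n - θ m = ∑ k ∈ Finset.Ico m n, α k • G (θ k) + ∑ k ∈ Finset.Ico m n, e k := by
    rw [← Finset.sum_add_distrib, ← Finset.sum_Ico_sub θ hmn]
    refine Finset.sum_congr rfl fun k _ => ?_
    rw [hθ k]; abel
  have h₁ : ‖∑ k ∈ Finset.Ico m n, e k‖ ≤ ε / (4 * L') := by
    have := hN₁ n ((le_max_left _ _).trans (hm.trans hmn)) m ((le_max_left _ _).trans hm)
    rw [dist_eq_norm, ← Finset.sum_Ico_eq_sub _ hmn] at this
    exact this.le
  have h₂ : ‖∑ k ∈ Finset.Ico m n, α k • G (θ k)‖ ≤ ε / (4 * L') := by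
    have h := hN₂ n ((le_max_right _ _).trans (hm.trans hmn)) m ((le_max_right _ _).trans hm)
    rw [dist_eq_norm, ← Finset.sum_Ico_eq_sub _ hmn, Real.norm_eq_abs] at h
    calc _ ≤ ∑ k ∈ Finset.Ico m n, ε⁻¹ * (α k * ‖G (θ k)‖ ^ 2) := by
          refine (norm_sum_le _ _).trans (Finset.sum_le_sum fun k hk => ?_)
          rw [norm_smul, Real.norm_eq_abs, abs_of_nonneg (hα₀ k), le_inv_mul_iff₀ hε]
          have := mul_le_mul_of_nonneg_left (hlt k hk).le
            (mul_nonneg (hα₀ k) (norm_nonneg (G (θ k))))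
          linarith
      _ ≤ ε⁻¹ * (ε ^ 2 / (4 * L')) := by
          rw [← Finset.mul_sum]
          exact mul_le_mul_of_nonneg_left ((le_abs_self _).trans h.le) (inv_pos.2 hε).le
      _ = ε / (4 * L') := by field_simp
  have h₃ : ‖G (θ n) - G (θ m)‖ ≤ ε / 2 := by
    refine (hG' _ _).trans ?_
    calc L' * ‖θ n - θ m‖ ≤ L' * (ε / (4 * L') + ε / (4 * L')) := by
          refine mul_le_mul_of_nonneg_left ?_ hL'.le
          rw [htel]
          exact (norm_add_le _ _).trans (add_le_add h₂ h₁)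
      _ = ε / 2 := by field_simp; norm_num
  have h₄ := norm_sub_norm_le (G (θ m)) (G (θ n))
  rw [norm_sub_rev] at h₄
  linarith

/-! ### Conditional laws, martingale series and almost sure summability. -/

/-- If the conditional law of `X` given `m` is `κ (Y ·)` with `Y` measurable with respect to `m`,
then conditional expectations of functions of `(Y, X)` are computed by integrating out `X`. -/
lemma condExp_eq_integral_of_condLaw {Ω T Z : Type*} [MeasurableSpace T] [MeasurableSpace Z]
    {m mΩ : MeasurableSpace Ω} {μ : Measure Ω} [IsProbabilityMeasure μ] (hm : m ≤ mΩ) (κ : Kernel T Z) [IsMarkovKernel κ]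
    {Y : Ω → T} (hY : Measurable[m] Y) {X : Ω → Z} (hX : Measurable X)
    (hlaw : ∀ B, MeasurableSet B → μ⟦X ⁻¹' B | m⟧ =ᵐ[μ] fun ω => (κ (Y ω)).real B)
    {φ : T × Z → ℝ} (hφ : Measurable φ) {C : ℝ} (hC : ∀ p, |φ p| ≤ C) :
    μ[fun ω => φ (Y ω, X ω) | m] =ᵐ[μ] fun ω => ∫ x, φ (Y ω, x) ∂κ (Y ω) := by
  have hY' : Measurable Y := hY.mono hm le_rfl
  have hI : Measurable fun t => ∫ x, φ (t, x) ∂κ t :=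
    hφ.stronglyMeasurable.integral_kernel_prod_right'.measurable
  -- Restricting to each event D of the past disintegrates the joint law there. On a rectangle s × t
  -- this is the conditional-law hypothesis integrated over Y ∈ s inside D.
  have hjoint : ∀ D, MeasurableSet[m] D → (μ.restrict D).map (fun ω => (Y ω, X ω)) =
      ((μ.restrict D).map Y) ⊗ₘ κ := by
    intro D hD
    refine Measure.ext_prod fun {s t} hs ht => ?_
    have hsm : MeasurableSet[m] (Y ⁻¹' s ∩ D) := (hY hs).inter hD
    have hκt : Measurable fun ω => (κ (Y ω)).real t :=
      ((Kernel.measurable_coe κ ht).comp hY').ennreal_toReal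
    rw [Measure.map_apply (hY'.prodMk hX) (hs.prod ht), Measure.compProd_apply_prod hs ht,
      setLIntegral_map hs (Kernel.measurable_coe κ ht) hY',
      Measure.restrict_restrict (hY' hs), Measure.restrict_apply (hY'.prodMk hX (hs.prod ht))]
    have h₁ := setIntegral_condExp hm (μ := μ) (f := (X ⁻¹' t).indicator fun _ => (1 : ℝ))
      ((integrable_const 1).indicator (hX ht)) hsm
    rw [setIntegral_congr_ae (g := fun ω => (κ (Y ω)).real t) (hm _ hsm)
      ((hlaw t ht).mono fun ω h _ => h), setIntegral_indicator (hX ht),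
      setIntegral_const, smul_eq_mul, mul_one] at h₁
    have h₂ := ofReal_integral_eq_lintegral_ofReal (μ := μ.restrict (Y ⁻¹' s ∩ D))
      (f := fun ω => (κ (Y ω)).real t)
      (Integrable.of_bound hκt.aestronglyMeasurable 1 (ae_of_all _ fun ω => by
        rw [Real.norm_eq_abs, abs_of_nonneg measureReal_nonneg]
        exact measureReal_le_one)) (ae_of_all _ fun ω => measureReal_nonneg)
    rw [h₁, ofReal_measureReal] at h₂
    have h₃ : ∀ ω, ENNReal.ofReal ((κ (Y ω)).real t) = κ (Y ω) t := fun ω => ofReal_measureReal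
    simp only [h₃] at h₂
    rw [← h₂]
    congr 1
    ext ω
    simp only [Set.mem_inter_iff, Set.mem_preimage, Set.mem_prod]
    tauto
  refine (ae_eq_condExp_of_forall_setIntegral_eq hm ?_ ?_ ?_ ?_).symm
  · exact integrable_of_abs_le (hφ.comp (hY'.prodMk hX)) fun _ => hC _
  · intro D _ _
    exact (integrable_of_abs_le (hI.comp hY') fun _ =>
      abs_integral_le_of_abs_le fun _ => hC _).integrableOn
  · intro D hD _
    have hb : Integrable φ (((μ.restrict D).map Y) ⊗ₘ κ) :=
      Integrable.of_bound hφ.aestronglyMeasurable C (ae_of_all _ hC)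
    have h := Measure.integral_compProd hb
    rw [← hjoint D hD, integral_map (hY'.prodMk hX).aemeasurable hφ.aestronglyMeasurable,
      integral_map hY'.aemeasurable hI.aestronglyMeasurable] at h
    exact h.symm
  · exact (hI.comp hY).aestronglyMeasurable

section Stochastic

variable {Ω : Type*} {mΩ : MeasurableSpace Ω} {μ : Measure Ω} [IsProbabilityMeasure μ]

/-- A series of bounded martingale differences with square-summable weights converges almost
surely. -/
lemma ae_tendsto_sum_martingale_diff {ℱ : Filtration ℕ mΩ} {η : ℕ → Ω → ℝ}
    (hm : ∀ k, Measurable[ℱ (k + 1)] (η k)) {C : ℝ} (hC : ∀ k ω, |η k ω| ≤ C)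
    (h0 : ∀ k, μ[η k | ℱ k] =ᵐ[μ] 0) {α : ℕ → ℝ} (hα : Summable fun k => α k ^ 2) :
    ∀ᵐ ω ∂μ, ∃ l, Tendsto (fun n => ∑ k ∈ Finset.range n, α k * η k ω) atTop (𝓝 l) := by
  set N : ℕ → Ω → ℝ := fun n ω => ∑ k ∈ Finset.range n, α k * η k ω with hN
  have hNm : ∀ n, Measurable[ℱ n] (N n) := fun n =>
    Finset.measurable_fun_sum _ fun k hk =>
      ((hm k).mono (ℱ.mono (Finset.mem_range.1 hk)) le_rfl).const_mul _
  have hηm : ∀ k, Measurable (η k) := fun k => (hm k).mono (ℱ.le _) le_rfl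
  have hNm' : ∀ n, Measurable (N n) := fun n => (hNm n).mono (ℱ.le n) le_rfl
  have hNb : ∀ n ω, |N n ω| ≤ ∑ k ∈ Finset.range n, |α k| * C := fun n ω =>
    (Finset.abs_sum_le_sum_abs _ _).trans (Finset.sum_le_sum fun k _ => by
      rw [abs_mul]; exact mul_le_mul_of_nonneg_left (hC k ω) (abs_nonneg _))
  have hNi : ∀ n, Integrable (N n) μ := fun n => integrable_of_abs_le (hNm' n) (hNb n)
  have hηi : ∀ k, Integrable (η k) μ := fun k => integrable_of_abs_le (hηm k) (hC k)
  have hmart : Martingale N ℱ μ := by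
    refine martingale_of_condExp_sub_eq_zero_nat (fun n => (hNm n).stronglyMeasurable) hNi
      fun n => ?_
    have : N (n + 1) - N n = α n • η n := by
      funext ω
      simp only [hN, Pi.sub_apply, Finset.sum_range_succ, add_sub_cancel_left, Pi.smul_apply,
        smul_eq_mul]
    rw [this]
    filter_upwards [condExp_smul (μ := μ) (α n) (η n) (ℱ n), h0 n] with ω h₁ h₂
    rw [h₁, Pi.smul_apply, h₂, Pi.zero_apply, smul_zero]
  -- The partial sum is known at time n and the next increment is centred given that past, so second
  -- moments add up.
  have horth : ∀ n, ∫ ω, N n ω * η n ω ∂μ = 0 := fun n => by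
    have hi : Integrable (N n * η n) μ :=
      (hηi n).bdd_mul (hNm' n).aestronglyMeasurable (ae_of_all _ (hNb n))
    have h := condExp_mul_of_stronglyMeasurable_left (hNm n).stronglyMeasurable hi (hηi n)
    have h' : ∫ ω, (N n * η n) ω ∂μ = 0 := by
      rw [← integral_condExp (ℱ.le n), integral_congr_ae h]
      refine integral_eq_zero_of_ae ?_
      filter_upwards [h0 n] with ω hω
      rw [Pi.mul_apply, hω]; simp
    exact h'
  have hsq : ∀ n, ∫ ω, N n ω ^ 2 ∂μ ≤ ∑ k ∈ Finset.range n, α k ^ 2 * C ^ 2 := by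
    intro n
    induction n with
    | zero => simp [hN]
    | succ n ih =>
      have hi₁ : Integrable (fun ω => N n ω ^ 2) μ :=
        integrable_of_abs_le ((hNm' n).pow_const 2) (K := (∑ k ∈ Finset.range n, |α k| * C) ^ 2)
          fun ω => by
            rw [abs_pow]; exact pow_le_pow_left₀ (abs_nonneg _) (hNb n ω) 2
      have hi₂ : Integrable (fun ω => N n ω * η n ω) μ :=
        (hηi n).bdd_mul (hNm' n).aestronglyMeasurable (ae_of_all _ (hNb n))
      have hb₃ : ∀ ω, |η n ω ^ 2| ≤ C ^ 2 := fun ω => by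
        rw [abs_pow]; exact pow_le_pow_left₀ (abs_nonneg _) (hC n ω) 2
      have hi₃ : Integrable (fun ω => η n ω ^ 2) μ :=
        integrable_of_abs_le ((hηm n).pow_const 2) hb₃
      have hex : ∀ ω, N (n + 1) ω ^ 2 =
          N n ω ^ 2 + 2 * α n * (N n ω * η n ω) + α n ^ 2 * η n ω ^ 2 := fun ω => by
        simp only [hN, Finset.sum_range_succ]; ring
      simp only [hex]
      have hi₁₂ : Integrable (fun ω => N n ω ^ 2 + 2 * α n * (N n ω * η n ω)) μ :=
        hi₁.add (hi₂.const_mul _)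
      rw [integral_add hi₁₂ (hi₃.const_mul _),
        integral_add hi₁ (hi₂.const_mul _), integral_const_mul, integral_const_mul, horth,
        mul_zero, add_zero, Finset.sum_range_succ]
      exact add_le_add ih (mul_le_mul_of_nonneg_left
        ((le_abs_self _).trans (abs_integral_le_of_abs_le hb₃)) (sq_nonneg _))
  set R : ℝ := 1 + (∑' k, α k ^ 2) * C ^ 2 with hR
  -- Martingale convergence asks for an L¹ bound; |x| ≤ 1 + x² derives it from the L² bound.
  have hL1 : ∀ n, eLpNorm (N n) 1 μ ≤ R.toNNReal := by
    intro n
    have hi₁ : Integrable (fun ω => N n ω ^ 2) μ :=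
      integrable_of_abs_le ((hNm' n).pow_const 2) (K := (∑ k ∈ Finset.range n, |α k| * C) ^ 2)
        fun ω => by
          rw [abs_pow]; exact pow_le_pow_left₀ (abs_nonneg _) (hNb n ω) 2
    rw [eLpNorm_one_eq_lintegral_enorm, ← ofReal_integral_norm_eq_lintegral_enorm (hNi n)]
    refine ENNReal.ofReal_le_ofReal ?_
    calc ∫ ω, ‖N n ω‖ ∂μ ≤ ∫ ω, (1 + N n ω ^ 2) ∂μ := by
          refine integral_mono (hNi n).norm ((integrable_const 1).add hi₁) fun ω => ?_
          dsimp only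
          rw [Real.norm_eq_abs, ← sq_abs]
          nlinarith [sq_nonneg (|N n ω| - 1), abs_nonneg (N n ω)]
      _ = 1 + ∫ ω, N n ω ^ 2 ∂μ := by
          rw [integral_add (integrable_const 1) hi₁]; simp
      _ ≤ R := by
          rw [hR]
          refine add_le_add le_rfl ((hsq n).trans ?_)
          rw [← Finset.sum_mul]
          exact mul_le_mul_of_nonneg_right (hα.sum_le_tsum _ fun k _ => sq_nonneg _)
            (sq_nonneg _)
  filter_upwards [hmart.submartingale.ae_tendsto_limitProcess hL1] with ω hω
  exact ⟨_, hω⟩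

omit [IsProbabilityMeasure μ] in
/-- If the partial sums of the expectations of nonnegative variables are bounded, the series
converges almost surely. -/
lemma ae_summable_of_sum_integral_le {u : ℕ → Ω → ℝ} (hu : ∀ k, Integrable (u k) μ)
    (hu₀ : ∀ k ω, 0 ≤ u k ω) {R : ℝ}
    (hR : ∀ n, ∑ k ∈ Finset.range n, ∫ ω, u k ω ∂μ ≤ R) :
    ∀ᵐ ω ∂μ, Summable fun k => u k ω := by
  -- By Tonelli the random sum has finite expectation, hence is almost surely finite.
  have hlt : ∫⁻ ω, ∑' k, ENNReal.ofReal (u k ω) ∂μ ≤ ENNReal.ofReal R := by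
    rw [lintegral_tsum fun k => (hu k).aestronglyMeasurable.aemeasurable.ennreal_ofReal]
    refine ENNReal.tsum_le_of_sum_range_le fun n => ?_
    rw [Finset.sum_congr rfl fun k _ => (ofReal_integral_eq_lintegral_ofReal (hu k)
      (ae_of_all _ (hu₀ k))).symm, ← ENNReal.ofReal_sum_of_nonneg fun k _ =>
        integral_nonneg (hu₀ k)]
    exact ENNReal.ofReal_le_ofReal (hR n)
  have hfin := ae_lt_top' (AEMeasurable.tsum fun k =>
    (hu k).aestronglyMeasurable.aemeasurable.ennreal_ofReal)
    (hlt.trans_lt ENNReal.ofReal_lt_top).ne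
  filter_upwards [hfin] with ω hω
  have := ENNReal.summable_toReal hω.ne
  simpa only [ENNReal.toReal_ofReal (hu₀ _ ω)] using this

end Stochastic

/-! ### Stochastic gradient ascent with bounded unbiased gradients. -/

/-- Almost sure stationarity of stochastic gradient ascent for a bounded objective with a uniform
quadratic expansion, with bounded unbiased stochastic gradients and Robbins-Monro stepsizes. -/
lemma ae_tendsto_norm_gradient_of_stochastic_ascent {d : ℕ} {Z Ω : Type*} [MeasurableSpace Z]
    {mΩ : MeasurableSpace Ω} {μ : Measure Ω} [IsProbabilityMeasure μ] {ℱ : Filtration ℕ mΩ}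
    {J : EuclideanSpace ℝ (Fin d) → ℝ} {G : EuclideanSpace ℝ (Fin d) → EuclideanSpace ℝ (Fin d)}
    {C CJ Cg : ℝ} (hJG : ∀ x y, |J y - J x - inner ℝ (G x) (y - x)| ≤ C * ‖y - x‖ ^ 2)
    (hC : 0 ≤ C) (hJ : ∀ x, |J x| ≤ CJ) (κ : Kernel (EuclideanSpace ℝ (Fin d)) Z) [IsMarkovKernel κ]
    {g : EuclideanSpace ℝ (Fin d) → Z → EuclideanSpace ℝ (Fin d)}
    (hg : Measurable fun p : EuclideanSpace ℝ (Fin d) × Z => g p.1 p.2)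
    (hgb : ∀ x z, ‖g x z‖ ≤ Cg) (hgG : ∀ x, ∫ z, g x z ∂κ x = G x)
    {α : ℕ → ℝ} (hα₀ : ∀ k, 0 ≤ α k)
    (hα : Tendsto (fun n => ∑ k ∈ Finset.range n, α k) atTop atTop)
    (hα₂ : Summable fun k => α k ^ 2) {X : ℕ → Ω → Z} {θ : ℕ → Ω → EuclideanSpace ℝ (Fin d)}
    (hθm : ∀ k, Measurable[ℱ k] (θ k)) (hXm : ∀ k, Measurable[ℱ (k + 1)] (X k))
    (hlaw : ∀ k B, MeasurableSet B →
      μ⟦X k ⁻¹' B | ℱ k⟧ =ᵐ[μ] fun ω => (κ (θ k ω)).real B)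
    (hθ : ∀ k ω, θ (k + 1) ω = θ k ω + α k • g (θ k ω) (X k ω)) :
    ∀ᵐ ω ∂μ, Tendsto (fun k => ‖G (θ k ω)‖) atTop (𝓝 0) := by
  have hGc := continuous_of_quadratic_expansion hJG
  have hJc : Continuous J := continuous_iff_continuousAt.2 fun x =>
    (hasGradientAt_of_quadratic_expansion hJG x).continuousAt
  have hgm : ∀ x, Measurable (g x) := fun x => hg.comp measurable_prodMk_left
  have hgi : ∀ x, Integrable (g x) (κ x) := fun x =>
    Integrable.of_bound (hgm x).aestronglyMeasurable Cg (ae_of_all _ (hgb x))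
  have hGb : ∀ x, ‖G x‖ ≤ Cg := fun x => by
    rw [← hgG x]
    simpa using norm_integral_le_of_norm_le_const (μ := κ x) (ae_of_all _ (hgb x))
  have hinner : ∀ x v, ∫ z, inner ℝ v (g x z) ∂κ x = inner ℝ v (G x) := fun x v => by
    rw [integral_inner (hgi x), hgG]
  have hCg : 0 ≤ Cg := (norm_nonneg _).trans (hGb 0)
  have hθm' : ∀ k, Measurable (θ k) := fun k => (hθm k).mono (ℱ.le k) le_rfl
  have hXm' : ∀ k, Measurable (X k) := fun k => (hXm k).mono (ℱ.le _) le_rfl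
  -- the noise is conditionally centred
  have hnoise : ∀ i, ∀ᵐ ω ∂μ, ∃ l, Tendsto (fun n => ∑ k ∈ Finset.range n,
      α k * (g (θ k ω) (X k ω) - G (θ k ω)) i) atTop (𝓝 l) := by
    intro i
    refine ae_tendsto_sum_martingale_diff (ℱ := ℱ)
      (η := fun k ω => (g (θ k ω) (X k ω) - G (θ k ω)) i) (C := Cg + Cg) (fun k => ?_)
      (fun k ω => ?_) (fun k => ?_) hα₂
    · have h₁ : Measurable[ℱ (k + 1)] (θ k) := (hθm k).mono (ℱ.mono k.le_succ) le_rfl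
      have h₂ : Measurable[ℱ (k + 1)] fun ω => g (θ k ω) (X k ω) :=
        hg.comp (h₁.prodMk (hXm k))
      exact (EuclideanSpace.proj (𝕜 := ℝ) i).continuous.measurable.comp
        (h₂.sub (hGc.measurable.comp h₁))
    · exact (PiLp.norm_apply_le _ i).trans
        ((norm_sub_le _ _).trans (add_le_add (hgb _ _) (hGb _)))
    · have h := condExp_eq_integral_of_condLaw (ℱ.le k) κ (hθm k) (hXm' k) (hlaw k)
        (φ := fun p => (g p.1 p.2 - G p.1) i)
        ((EuclideanSpace.proj (𝕜 := ℝ) i).continuous.measurable.comp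
          (hg.sub (hGc.measurable.comp measurable_fst))) (C := Cg + Cg)
        (fun p => (PiLp.norm_apply_le _ i).trans
          ((norm_sub_le _ _).trans (add_le_add (hgb _ _) (hGb _))))
      refine h.trans (ae_of_all _ fun ω => ?_)
      have hi : ∀ w : EuclideanSpace ℝ (Fin d), w i =
          inner ℝ (EuclideanSpace.single i (1 : ℝ)) w := fun w => by
        simp [EuclideanSpace.inner_single_left]
      simp only [hi, inner_sub_right]
      rw [integral_sub ((hgi _).const_inner _) (integrable_const _), hinner]
      simp
  -- the gradients are square-summable along the stepsizes
  have hsum : ∀ᵐ ω ∂μ, Summable fun k => α k * ‖G (θ k ω)‖ ^ 2 := by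
    have hGθ : ∀ k, Measurable fun ω => G (θ k ω) := fun k => hGc.measurable.comp (hθm' k)
    have hGi : ∀ k, Integrable (fun ω => ‖G (θ k ω)‖ ^ 2) μ := fun k =>
      integrable_of_abs_le ((hGθ k).norm.pow_const 2) (K := Cg ^ 2) fun ω => by
        rw [abs_pow, abs_norm]; exact pow_le_pow_left₀ (norm_nonneg _) (hGb _) 2
    have hJi : ∀ k, Integrable (fun ω => J (θ k ω)) μ := fun k =>
      integrable_of_abs_le (hJc.measurable.comp (hθm' k)) fun _ => hJ _
    have hφm : Measurable fun p : EuclideanSpace ℝ (Fin d) × Z =>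
        (inner ℝ (G p.1) (g p.1 p.2) : ℝ) := (hGc.measurable.comp measurable_fst).inner hg
    have hφb : ∀ p : EuclideanSpace ℝ (Fin d) × Z,
        |(inner ℝ (G p.1) (g p.1 p.2) : ℝ)| ≤ Cg * Cg := fun p =>
      (abs_real_inner_le_norm _ _).trans
        (mul_le_mul (hGb _) (hgb _ _) (norm_nonneg _) hCg)
    have hmean : ∀ k, ∫ ω, inner ℝ (G (θ k ω)) (g (θ k ω) (X k ω)) ∂μ =
        ∫ ω, ‖G (θ k ω)‖ ^ 2 ∂μ := fun k => by
      have h := condExp_eq_integral_of_condLaw (ℱ.le k) κ (hθm k) (hXm' k) (hlaw k) hφm hφb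
      rw [← integral_condExp (ℱ.le k), integral_congr_ae h]
      simp only [hinner, real_inner_self_eq_norm_sq]
    -- Expected ascent inequality: the linear term averages to α_k E‖G(θ_k)‖² by `hmean`, and the
    -- quadratic error is at most C Cg² α_k². Boundedness of J then controls the telescoping sum.
    have hstep : ∀ k, α k * ∫ ω, ‖G (θ k ω)‖ ^ 2 ∂μ ≤
        ∫ ω, J (θ (k + 1) ω) ∂μ - ∫ ω, J (θ k ω) ∂μ + C * Cg ^ 2 * α k ^ 2 := fun k => by
      have hi : Integrable (fun ω => (inner ℝ (G (θ k ω)) (g (θ k ω) (X k ω)) : ℝ)) μ :=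
        integrable_of_abs_le (hφm.comp ((hθm' k).prodMk (hXm' k))) fun _ => hφb (_, _)
      have hi' : Integrable (fun ω => J (θ (k + 1) ω) - J (θ k ω)) μ := (hJi _).sub (hJi _)
      rw [← hmean, ← integral_const_mul, ← integral_sub (hJi _) (hJi _)]
      have hc : ∫ _ω, C * Cg ^ 2 * α k ^ 2 ∂μ = C * Cg ^ 2 * α k ^ 2 := by simp
      rw [← hc, ← integral_add hi' (integrable_const _)]
      refine integral_mono (hi.const_mul _) (hi'.add (integrable_const _)) fun ω => ?_
      have h := (abs_le.1 (hJG (θ k ω) (θ (k + 1) ω))).1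
      have hdiff : θ (k + 1) ω - θ k ω = α k • g (θ k ω) (X k ω) := by
        rw [hθ k ω, add_sub_cancel_left]
      have hn : C * ‖α k • g (θ k ω) (X k ω)‖ ^ 2 ≤ C * Cg ^ 2 * α k ^ 2 := by
        rw [norm_smul, Real.norm_eq_abs, mul_pow, sq_abs]
        have := pow_le_pow_left₀ (norm_nonneg _) (hgb (θ k ω) (X k ω)) 2
        nlinarith [mul_le_mul_of_nonneg_left this (mul_nonneg hC (sq_nonneg (α k)))]
      rw [hdiff, inner_smul_right] at h
      dsimp only
      linarith
    have hbound : ∀ n, ∑ k ∈ Finset.range n, ∫ ω, α k * ‖G (θ k ω)‖ ^ 2 ∂μ ≤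
        CJ + CJ + |C * Cg ^ 2| * ∑' k, α k ^ 2 := fun n => by
      simp only [integral_const_mul]
      refine (Finset.sum_le_sum fun k _ => hstep k).trans ?_
      rw [Finset.sum_add_distrib, Finset.sum_range_sub (fun k => ∫ ω, J (θ k ω) ∂μ),
        ← Finset.mul_sum]
      have h₁ := abs_le.1 (abs_integral_le_of_abs_le (μ := μ) fun ω => hJ (θ n ω))
      have h₂ := abs_le.1 (abs_integral_le_of_abs_le (μ := μ) fun ω => hJ (θ 0 ω))
      have h₃ : C * Cg ^ 2 * ∑ k ∈ Finset.range n, α k ^ 2 ≤ |C * Cg ^ 2| * ∑' k, α k ^ 2 :=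
        mul_le_mul (le_abs_self _) (hα₂.sum_le_tsum _ fun _ _ => sq_nonneg _)
          (Finset.sum_nonneg fun _ _ => sq_nonneg _) (abs_nonneg _)
      linarith [h₁.2, h₂.1]
    exact ae_summable_of_sum_integral_le (fun k => (hGi k).const_mul _)
      (fun k ω => mul_nonneg (hα₀ k) (sq_nonneg _)) hbound
  filter_upwards [ae_all_iff.2 hnoise, hsum] with ω hω₁ hω₂
  refine tendsto_norm_zero_of_perturbed_recursion (G := G) (θ := fun k => θ k ω)
    (e := fun k => α k • (g (θ k ω) (X k ω) - G (θ k ω)))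
    (norm_sub_le_of_quadratic_expansion hJG) hα₀ hα (fun k => ?_) ?_ hω₂
  · rw [hθ k ω, smul_sub]; abel
  · choose l hl using hω₁
    refine Tendsto.cauchySeq (x := WithLp.toLp 2 l) ?_
    have h : Tendsto (fun n i => ∑ k ∈ Finset.range n, α k * (g (θ k ω) (X k ω) - G (θ k ω)) i)
        atTop (𝓝 l) := tendsto_pi_nhds.2 hl
    have h' := ((PiLp.continuous_toLp 2 fun _ : Fin d => ℝ).tendsto l).comp h
    refine h'.congr fun n => ?_
    ext i
    simp

end

/-! ### Stationarity of the random-horizon policy gradient iterates. -/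

theorem theorem2 {d : ℕ} {S A : Type*} [MeasurableSpace S] [MeasurableSpace A]
    {ν : Measure A} [SigmaFinite ν]
    (M : RPG.MDP S A) (π : RPG.PolicyFamily d S ν) (hreg : M.Regular π)
    (s₀ : S) (θ₀ : RPG.Param d) (α : ℕ → ℝ) (hα : RPG.RobbinsMonro α)
    {Ω : Type*} {mΩ : MeasurableSpace Ω} (μ : Measure Ω) [IsProbabilityMeasure μ]
    (ℱ : Filtration ℕ mΩ) (X : ℕ → Ω → RPG.Rollout S A × RPG.Rollout S A)
    (θ : ℕ → Ω → RPG.Param d) (hθ : M.IsRPG π μ ℱ s₀ θ₀ α X θ) :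
    Differentiable ℝ (M.objective π s₀) ∧
    ∀ᵐ ω ∂μ,
      Tendsto (fun k => ‖gradient (M.objective π s₀) (θ k ω)‖) atTop (𝓝 0) ∧
      ∀ θlim : RPG.Param d, MapClusterPt θlim atTop (fun k => θ k ω) →
        θlim ∈ M.stationaryPoints π s₀ := by
  obtain ⟨U, hU⟩ := hreg.bounded_reward
  have hπ := hreg.differentiable_density
  obtain ⟨L, hL₀, hL⟩ : ∃ L : ℝ, 0 ≤ L ∧
      ∀ x θ₁ θ₂, ‖π.score θ₁ x - π.score θ₂ x‖ ≤ L * ‖θ₁ - θ₂‖ := by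
    obtain ⟨L, hL⟩ := hreg.lipschitz_score
    exact ⟨|L|, abs_nonneg L, fun x θ₁ θ₂ => (hL x θ₁ θ₂).trans
      (mul_le_mul_of_nonneg_right (le_abs_self L) (norm_nonneg _))⟩
  obtain ⟨B, hB₀, hB⟩ : ∃ B : ℝ, 0 ≤ B ∧ ∀ x θ, ‖π.score θ x‖ ≤ B := by
    obtain ⟨B, hB⟩ := hreg.bounded_score
    exact ⟨|B|, abs_nonneg B, fun x θ => (hB x θ).trans (le_abs_self B)⟩
  have hU₀ : 0 ≤ U := by
    obtain ⟨a⟩ := (π.kernel θ₀ s₀).nonempty_of_neZero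
    exact (abs_nonneg _).trans (hU (s₀, a))
  have hγ₀ := M.discount_pos
  have hγ₁ : 0 < 1 - M.discount := by linarith [M.discount_lt_one]
  have hJ : ∀ η, |M.objective π s₀ η| ≤ U / (1 - M.discount) := fun η => by
    rw [M.objective_eq_vValue π hU]
    exact M.abs_vValue_le π η hU s₀
  -- G is the mean update direction by definition, so unbiasedness is `rfl`; that it is the gradient
  -- of J is what the expansion below establishes.
  set G : RPG.Param d → RPG.Param d := fun η =>
    ∫ x, M.gradEst π η x ∂M.iterationLaw π s₀ η with hG
  obtain ⟨C, hC, hJG⟩ : ∃ C : ℝ, 0 ≤ C ∧ ∀ η η' : RPG.Param d,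
      |M.objective π s₀ η' - M.objective π s₀ η - inner ℝ (G η) (η' - η)| ≤
        C * ‖η' - η‖ ^ 2 := by
    refine ⟨((3 * B ^ 2 + L) * (U / (1 - M.discount)) + M.discount *
      (2 * B * (U / (1 - M.discount) * B / (1 - M.discount)))) / (1 - M.discount),
      by positivity, fun η η' => ?_⟩
    rw [M.objective_eq_vValue π hU, M.objective_eq_vValue π hU,
      M.inner_integral_gradEst hU hB hπ s₀ η (η' - η)]
    exact M.abs_vValue_sub_sub_le hπ hB hB₀ M.measurable_reward hU hL hL₀ η η' s₀
  have hgrad := hasGradientAt_of_quadratic_expansion hJG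
  have hcont := continuous_of_quadratic_expansion hJG
  have hdens : ∀ s a, Continuous fun η => π.density η s a := fun s a => (hπ s a).continuous
  refine ⟨fun η => (hgrad η).differentiableAt, ?_⟩
  let κ : Kernel (RPG.Param d) (RPG.Rollout S A × RPG.Rollout S A) :=
    ⟨fun η => M.iterationLaw π s₀ η, M.measurable_iterationLaw hdens s₀⟩
  have : IsMarkovKernel κ :=
    ⟨fun η => inferInstanceAs (IsProbabilityMeasure (M.iterationLaw π s₀ η))⟩
  have hmain := ae_tendsto_norm_gradient_of_stochastic_ascent hJG hC hJ κ
    (M.measurable_gradEst_param hπ hL) (M.norm_gradEst_le hU hB) (fun _ => rfl)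
    hα.nonneg hα.sum_eq_top hα.summable_sq hθ.measurable_param hθ.measurable_sample
    hθ.condLaw_sample hθ.param_succ
  filter_upwards [hmain] with ω hω
  refine ⟨by simpa only [(hgrad _).gradient] using hω, fun θlim hlim => ?_⟩
  have hzero : ‖G θlim‖ = 0 := by
    -- By continuity of G, ‖G θlim‖ is a cluster value of a sequence converging to 0, so it is 0.
    have h₁ : MapClusterPt ‖G θlim‖ atTop fun k => ‖G (θ k ω)‖ :=
      hlim.continuousAt_comp (f := fun η => ‖G η‖) hcont.norm.continuousAt
    exact eq_of_nhds_neBot (ClusterPt.mono h₁ hω)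
  have h := hgrad θlim
  rwa [norm_eq_zero.1 hzero] at h
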